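/- **Theorem (Nash inequality).** Let $\Gamma$ be an infinite, connected, locally finite graph with a symmetric weight $\mu_{xy}\ge 0$ such that $\mu_{xy}>0$ if and only if $x\sim y$. Put $\mu(x)=\sum_{y\sim x}\mu_{xy}$ and $\mu(A)=\sum_{x\in A}\mu(x)$, let $d$ be the graph distance, $B(x,r)=\{y: d(x,y)\le r\}$ and $V_\mu(x,r)=\mu(B(x,r))$. Let $p_n(x,y)=P_n(x,y)/\mu(y)$, where $P_n$ is the $n$-step transition probability of the random walk with $P(x,y)=\mu_{xy}/\mu(x)$. Assume: 1. there is $C_\mu\ge 1$ with $C_\mu^{-1}\le\mu(x)\le C_\mu$ for all $x\in\Gamma$; 2. $V:[0,\infty)\to(0,\infty)$ is continuous and strictly increasing, and there are $C_D,C_h>1$ with $V(2r)\le C_D V(r)$ and $C_h^{-1}V(r)\le V_\mu(x,r)\le C_h V(r)$ for all $x\in\Gamma$, $r>0$; 3. there are $\gamma>1$ and $c,C>0$ such that for all $x,y\in\Gamma$ $$p_n(x,y)\le \frac{C}{V(n^{1/\gamma})}\exp\Big[-\Big(\frac{d(x,y)^\gamma}{Cn}\Big)^{\frac1{\gamma-1}}\Big]\quad\text{for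 all integers } n\ge 1,$$ $$p_n(x,y)+p_{n+1}(x,y)\ge \frac{c}{V(n^{1/\gamma})}\exp\Big[-\Big(\frac{d(x,y)^\gamma}{cn}\Big)^{\frac1{\gamma-1}}\Big]\quad\text{for all integers } n\ge \max(1,d(x,y)).$$ Let $\phi:[0,\infty)\to[1,\infty)$ be continuous and regularly varying at infinity of index $\beta>0$, i.e. $\phi(at)/\phi(t)\to a^\beta$ as $t\to\infty$ for every $a>0$. Let $K$ be a Markov operator with symmetric kernel $k$ with respect to $\mu$, i.e. $Kf(x)=\sum_y k(x,y)f(y)\mu(y)$ with $k(x,y)=k(y,x)\ge0$ and $\sum_y k(x,y)\mu(y)=1$ for all $x$, satisfying condition $(J_\phi)$: there is $C_\phi>0$ with $$\frac{C_\phi^{-1}}{V(d(x,y))\,\phi(d(x,y))}\le k(x,y)\le \frac{C_\phi}{V(d(x,y))\,\phi(d(x,y))}\qquad\text{for all }x,y\in\Gamma.$$ Let $\|\cdot\|_p$ be the norm of (real) $\ell^p(\Gamma,\mu)$, $\langle\cdot,\cdot\rangle$ the inner product of $\ell^2(\Gamma,\mu)$, and $\mathcal E_{K^2}(f,f)=\langle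 (I-K^2)f,f\rangle$. Define $$\eta(R)=\frac{R^\gamma}{\int_0^R \frac{s^{\gamma-1}}{\phi(s)}\,ds}\ (R>0),\qquad \eta(0)=\gamma\phi(0),\qquad \tilde\eta(R)=\sup\{\eta(t):t\in[0,R]\}.$$ Then there exist constants $C_1,C_2>0$ such that for every nonzero $f\in\ell^1(\Gamma,\mu)$ the number $C_2\|f\|_1^2/\|f\|_2^2$ lies in $V([0,\infty))$, where $V^{-1}$ is defined, and $$\|f\|_2^2\le C_1\,\mathcal E_{K^2}(f,f)\,\tilde\eta\Big(V^{-1}\Big(C_2\frac{\|f\|_1^2}{\|f\|_2^2}\Big)\Big);$$ for $f=0$ the inequality is read as $0\le 0$. -/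

import Mathlib

open Set Filter Topology

noncomputable section

/-- A connected, locally finite graph on `Γ` endowed with a symmetric non-negative weight; `x` and
`y` are neighbours exactly when the weight of the pair is positive (loops are permitted). -/
structure WeightedGraph (Γ : Type*) where
  weight : Γ → Γ → ℝ
  weight_symm : ∀ x y, weight x y = weight y x
  weight_nonneg : ∀ x y, 0 ≤ weight x y
  locallyFinite : ∀ x, {y | 0 < weight x y}.Finite
  connected : (SimpleGraph.fromRel fun x y => 0 < weight x y).Connected

namespace WeightedGraph

variable {Γ : Type*} (G : WeightedGraph Γ)

/-- The underlying graph (without its loops, which do not affect the distance). -/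
def graph : SimpleGraph Γ := SimpleGraph.fromRel fun x y => 0 < G.weight x y

/-- The vertex weight `μ(x) = ∑_{y ∼ x} μ_{xy}` (a finite sum). -/
def mu (x : Γ) : ℝ := ∑' y, G.weight x y

/-- The graph distance, as a real number. -/
def d (x y : Γ) : ℝ := (G.graph.dist x y : ℝ)

/-- The closed metric ball `B(x, r)`. -/
def ball (x : Γ) (r : ℝ) : Set Γ := {y | G.d x y ≤ r}

/-- The volume `V_μ(x, r) = μ(B(x, r))` (a finite sum, by local finiteness). -/
def vol (x : Γ) (r : ℝ) : ℝ := ∑' y : G.ball x r, G.mu y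

/-- The one-step transition probability of the natural random walk. -/
def P (x y : Γ) : ℝ := G.weight x y / G.mu x

open Classical in
/-- The `n`-step transition probability of the natural random walk. -/
def Pn : ℕ → Γ → Γ → ℝ
  | 0, x, y => if x = y then 1 else 0
  | n + 1, x, y => ∑' z, G.P x z * Pn n z y

/-- The heat kernel `p_n(x, y) = P_n(x, y) / μ(y)`. -/
def heatKernel (n : ℕ) (x y : Γ) : ℝ := G.Pn n x y / G.mu y

/-- The measure `μ` is comparable to the counting measure. -/
def ComparableToCounting : Prop :=
  ∃ C : ℝ, 1 ≤ C ∧ ∀ x, C⁻¹ ≤ G.mu x ∧ G.mu x ≤ C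

/-- `V : [0, ∞) → (0, ∞)` is a continuous strictly increasing doubling function which is
comparable to the volume growth of `(Γ, μ)`, uniformly in the centre of the balls. -/
structure HasVolumeGrowth (V : ℝ → ℝ) : Prop where
  pos : ∀ r, 0 ≤ r → 0 < V r
  strictMonoOn : StrictMonoOn V (Ici 0)
  continuousOn : ContinuousOn V (Ici 0)
  doubling : ∃ C : ℝ, 1 < C ∧ ∀ r, 0 < r → V (2 * r) ≤ C * V r
  homogeneous : ∃ C : ℝ, 1 < C ∧ ∀ x r, 0 < r → C⁻¹ * V r ≤ G.vol x r ∧ G.vol x r ≤ C * V r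

/-- The sub-Gaussian upper heat kernel bound with escape time exponent `γ`. -/
def SubGaussianUpper (V : ℝ → ℝ) (γ : ℝ) : Prop :=
  ∃ C : ℝ, 0 < C ∧ ∀ (x y : Γ) (n : ℕ), 1 ≤ n →
    G.heatKernel n x y ≤
      C / V ((n : ℝ) ^ (1 / γ)) * Real.exp (-((G.d x y ^ γ / (C * n)) ^ (1 / (γ - 1))))

/-- The sub-Gaussian lower heat kernel bound with escape time exponent `γ`. -/
def SubGaussianLower (V : ℝ → ℝ) (γ : ℝ) : Prop :=
  ∃ c : ℝ, 0 < c ∧ ∀ (x y : Γ) (n : ℕ), 1 ≤ n → G.d x y ≤ n →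
    c / V ((n : ℝ) ^ (1 / γ)) * Real.exp (-((G.d x y ^ γ / (c * n)) ^ (1 / (γ - 1)))) ≤
      G.heatKernel n x y + G.heatKernel (n + 1) x y

/-- `f ∈ ℓ¹(Γ, μ)`. -/
def MemL1 (f : Γ → ℝ) : Prop := Summable fun x => |f x| * G.mu x

/-- The norm of `ℓ¹(Γ, μ)`. -/
def l1Norm (f : Γ → ℝ) : ℝ := ∑' x, |f x| * G.mu x

/-- The inner product of `ℓ²(Γ, μ)`. -/
def innerProd (f g : Γ → ℝ) : ℝ := ∑' x, f x * g x * G.mu x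

/-- The norm of `ℓ²(Γ, μ)`. -/
def l2Norm (f : Γ → ℝ) : ℝ := √(G.innerProd f f)

/-- The operator with kernel `k` with respect to `μ`: `K f(x) = ∑_y k(x, y) f(y) μ(y)`. -/
def kernelOp (k : Γ → Γ → ℝ) (f : Γ → ℝ) : Γ → ℝ := fun x => ∑' y, k x y * f y * G.mu y

/-- The form `ℰ_T(f, g) = ⟨(I - T) f, g⟩` of an operator `T`. -/
def dirichletForm (T : (Γ → ℝ) → Γ → ℝ) (f g : Γ → ℝ) : ℝ := G.innerProd (f - T f) g

/-- `k` is the kernel with respect to `μ` of a Markov operator: the numbers `k(x, y) μ(y)` are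
transition probabilities. -/
def IsMarkov (k : Γ → Γ → ℝ) : Prop :=
  (∀ x y, 0 ≤ k x y) ∧ ∀ x, HasSum (fun y => k x y * G.mu y) 1

/-- Condition `(J_φ)` for the kernel `k`. -/
def SatisfiesJ (V φ : ℝ → ℝ) (k : Γ → Γ → ℝ) : Prop :=
  (∀ x y, k x y = k y x) ∧
  ∃ C : ℝ, 0 < C ∧ ∀ x y,
    C⁻¹ * (1 / (V (G.d x y) * φ (G.d x y))) ≤ k x y ∧
      k x y ≤ C * (1 / (V (G.d x y) * φ (G.d x y)))

end WeightedGraph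

/-- `φ` is regularly varying (at infinity) with index `β`. -/
def RegularlyVarying (φ : ℝ → ℝ) (β : ℝ) : Prop :=
  ∀ a : ℝ, 0 < a → Tendsto (fun t => φ (a * t) / φ t) atTop (𝓝 (a ^ β))

/-- `η(R) = R^γ / ∫_0^R s^{γ-1} / φ(s) ds` for `R > 0`, and `η(0) = γ φ(0)`. -/
def etaFun (γ : ℝ) (φ : ℝ → ℝ) (R : ℝ) : ℝ :=
  if R = 0 then γ * φ 0 else R ^ γ / ∫ s in (0 : ℝ)..R, s ^ (γ - 1) / φ s

/-- The non-decreasing envelope `η̃(R) = sup {η(t) : t ∈ [0, R]}`. -/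
def etaTilde (γ : ℝ) (φ : ℝ → ℝ) (R : ℝ) : ℝ := sSup (etaFun γ φ '' Icc 0 R)

/-- The inverse of a function `V` that is injective on `[0, ∞)`, meaningful on the set of values
`V '' [0, ∞)`. -/
def invIci (V : ℝ → ℝ) : ℝ → ℝ := Function.invFunOn V (Ici 0)

end

/-!
The Nash inequality follows from a smoothing argument, with powers `Pⁿ` of the natural random walk
as averaging operators. For `f ∈ ℓ¹` write `‖f‖² = (‖f‖² - ‖Pⁿ f‖²) + ‖Pⁿ f‖²`, where `n ≈ (2ᴶ)^γ`
is the time scale which belongs to the radius `2ᴶ ≈ r`.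

The second term is at most `(A / V(r)) ‖f‖₁²` by the on-diagonal heat kernel bound
(`exists_innerProd_Pn_scaleTime_le`). If `V(r)` is a large multiple of `‖f‖₁² / ‖f‖₂²`, this is at
most half of `‖f‖₂²`. Such an `r` exists since `V` is continuous and, the graph being infinite,
unbounded, and since `‖f‖₂² ≤ C ‖f‖₁²`.

The first term satisfies the pseudo-Poincaré inequality `‖f‖² - ‖Pⁿ f‖² ≤ A η̃(r) ℰ_{K²}(f, f)`
(`exists_pseudoPoincare_etaTilde`), for which three facts are combined.

* Write `n_j ≈ (2ʲ)^γ`. The sub-Gaussian bound gives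
  `∑_j p_{n_j}(x, y) / φ(2ʲ) ≤ A / (V φ)(d(x, y)) ≤ A' k(x, y)`
  (`HasVolumeGrowth.exists_sum_subGaussian_le`): scales above `d(x, y)` add up to a geometric series
  because `φ` grows at least geometrically, those below because of the sub-Gaussian factor. Values
  of `φ` at points that are not powers of two are reached by the local uniformity of regular
  variation, which for continuous functions follows from Baire's theorem
  (`RegularlyVarying.exists_le_mul`).
* The loss `‖f‖² - ‖Q f‖²` of an invariant Markov operator `Q` is an integral of variances. It is
  therefore at most the energy `∑ (f(y) - f(x))² q(x, y) μ(x)`, and conversely it controls this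
  energy if `q(x, x)` is bounded below (`IsInvariantMarkov.energy_le_of_lazy`), as it is for `K`,
  whose loss is `ℰ_{K²}(f, f)`. Hence `∑_j (‖f‖² - ‖P^{n_j} f‖²) / φ(2ʲ) ≤ A ℰ_{K²}(f, f)`.
* By reversibility `n ↦ ‖Pⁿ f‖²` is convex (`innerProd_Pn_convex`), so that the loss at scale `j ≤ J`
  is at least `n_j / n_J` times the loss at scale `J`. The resulting coefficient
  `n_J⁻¹ ∑_{j ≤ J} n_j / φ(2ʲ)` is a dyadic sum for `r^{-γ} ∫_0^r s^{γ-1} / φ(s) ds = 1 / η(r)`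
  (`exists_integral_le_sum`).
-/

/-! ### Markov matrices -/

section Markov

variable {Γ : Type*}

/-- The operator `f ↦ ∑_y q(x, y) f(y)` of a matrix `q`. -/
noncomputable def matrixOp (q : Γ → Γ → ℝ) (f : Γ → ℝ) (x : Γ) : ℝ := ∑' y, q x y * f y

theorem summable_weight_mul_of_bounded {w f : Γ → ℝ} {B : ℝ} (hw : ∀ y, 0 ≤ w y) (hs : Summable w)
    (hf : ∀ y, |f y| ≤ B) : Summable fun y => w y * f y := by
  refine Summable.of_norm_bounded (hs.mul_right B) fun y => ?_
  rw [Real.norm_eq_abs, abs_mul, abs_of_nonneg (hw y)]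
  exact mul_le_mul_of_nonneg_left (hf y) (hw y)

theorem sq_le_sq_of_bounded {f : Γ → ℝ} {B : ℝ} (hf : ∀ y, |f y| ≤ B) (y : Γ) :
    |f y ^ 2| ≤ B ^ 2 := by
  rw [abs_pow]
  exact pow_le_pow_left₀ (abs_nonneg _) (hf y) 2

/-- The second moment of `f` about `a`, for a probability vector `w`. -/
theorem hasSum_weight_mul_sub_sq {w f : Γ → ℝ} {B : ℝ} (hw : ∀ y, 0 ≤ w y) (hs : HasSum w 1)
    (hf : ∀ y, |f y| ≤ B) (a : ℝ) :
    HasSum (fun y => w y * (f y - a) ^ 2)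
      (∑' y, w y * f y ^ 2 - 2 * a * ∑' y, w y * f y + a ^ 2) := by
  have h1 := (summable_weight_mul_of_bounded hw hs.summable hf).hasSum
  have h2 := (summable_weight_mul_of_bounded hw hs.summable (sq_le_sq_of_bounded hf)).hasSum
  convert (h2.sub (h1.mul_left (2 * a))).add (hs.mul_right (a ^ 2)) using 1
  · rfl
  · funext y; ring
  · rw [one_mul]

/-- The variance of `f` is at most its second moment about any point. -/
theorem variance_le_tsum_sub_sq {w f : Γ → ℝ} {B : ℝ} (hw : ∀ y, 0 ≤ w y) (hs : HasSum w 1)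
    (hf : ∀ y, |f y| ≤ B) (a : ℝ) :
    ∑' y, w y * f y ^ 2 - (∑' y, w y * f y) ^ 2 ≤ ∑' y, w y * (f y - a) ^ 2 := by
  rw [(hasSum_weight_mul_sub_sq hw hs hf a).tsum_eq]
  nlinarith [sq_nonneg (a - ∑' y, w y * f y)]

/-- At an atom `x` of mass at least `ε`, the second moment about `f x` is controlled by the
variance: the variance is at least `ε (f x - m)²` where `m` is the mean. -/
theorem tsum_sub_sq_le_variance {w f : Γ → ℝ} {B ε : ℝ} (hw : ∀ y, 0 ≤ w y) (hs : HasSum w 1)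
    (hf : ∀ y, |f y| ≤ B) (hε : 0 < ε) {x : Γ} (hx : ε ≤ w x) :
    ∑' y, w y * (f y - f x) ^ 2 ≤
      (1 + ε⁻¹) * (∑' y, w y * f y ^ 2 - (∑' y, w y * f y) ^ 2) := by
  rw [(hasSum_weight_mul_sub_sq hw hs hf (f x)).tsum_eq]
  have h := hasSum_weight_mul_sub_sq hw hs hf (∑' y, w y * f y)
  have h2 := h.summable.le_tsum x fun y _ => mul_nonneg (hw y) (sq_nonneg _)
  rw [h.tsum_eq] at h2
  set m := ∑' y, w y * f y
  set s := ∑' y, w y * f y ^ 2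
  have h3 : ε * (f x - m) ^ 2 ≤ s - m ^ 2 := by
    nlinarith [mul_le_mul_of_nonneg_right hx (sq_nonneg (f x - m))]
  have h4 : (f x - m) ^ 2 ≤ ε⁻¹ * (s - m ^ 2) := by
    rw [inv_mul_eq_div, le_div_iff₀ hε]; linarith
  nlinarith

theorem abs_matrixOp_le {q : Γ → Γ → ℝ} {f : Γ → ℝ} {B : ℝ} (hq : ∀ x y, 0 ≤ q x y)
    (hs : ∀ x, HasSum (q x) 1) (hf : ∀ y, |f y| ≤ B) (x : Γ) :
    |matrixOp q f x| ≤ matrixOp q (fun y => |f y|) x := by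
  have h := summable_weight_mul_of_bounded (f := fun y => |f y|) (hq x) (hs x).summable (B := B)
    (by simpa using hf)
  refine tsum_of_norm_bounded (E := ℝ) h.hasSum fun y => ?_
  rw [Real.norm_eq_abs, abs_mul, abs_of_nonneg (hq x y)]

/-- The operator of a product of stochastic matrices is the composition of the operators. -/
theorem matrixOp_comp {q r : Γ → Γ → ℝ} {f : Γ → ℝ} {B : ℝ} (hq : ∀ x y, 0 ≤ q x y)
    (hqs : ∀ x, HasSum (q x) 1) (hr : ∀ x y, 0 ≤ r x y) (hrs : ∀ x, HasSum (r x) 1)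
    (hf : ∀ y, |f y| ≤ B) (x : Γ) :
    HasSum (fun y => (∑' z, q x z * r z y) * f y) (matrixOp q (matrixOp r f) x) := by
  have hbase : Summable fun p : Γ × Γ => q x p.1 * r p.1 p.2 := by
    have hnn : 0 ≤ fun p : Γ × Γ => q x p.1 * r p.1 p.2 := fun p =>
      mul_nonneg (hq _ _) (hr _ _)
    refine (summable_prod_of_nonneg hnn).2 ⟨fun z => ?_, ?_⟩
    · exact (hrs z).summable.mul_left (q x z)
    simp only [tsum_mul_left, (hrs _).tsum_eq, mul_one]
    exact (hqs x).summable
  have hF : Summable fun p : Γ × Γ => q x p.1 * r p.1 p.2 * f p.2 :=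
    summable_weight_mul_of_bounded (w := fun p : Γ × Γ => q x p.1 * r p.1 p.2)
      (f := fun p : Γ × Γ => f p.2) (B := B) (fun p => mul_nonneg (hq x p.1) (hr p.1 p.2)) hbase
      fun p => hf p.2
  have h1 : matrixOp q (matrixOp r f) x = ∑' p : Γ × Γ, q x p.1 * r p.1 p.2 * f p.2 := by
    rw [hF.tsum_prod]
    simp only [matrixOp, ← tsum_mul_left, mul_assoc]
  rw [h1]
  have h2 := hF.prod_symm.hasSum.prod_fiberwise (fun y => (hF.prod_symm.prod_factor y).hasSum)
  convert h2 using 1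
  · funext y
    simp [tsum_mul_right]
  · exact ((Equiv.prodComm Γ Γ).tsum_eq fun p : Γ × Γ => q x p.1 * r p.1 p.2 * f p.2).symm

end Markov

/-! ### Summable functions and reversible operators on a weighted graph -/

namespace WeightedGraph

variable {Γ : Type*} {G : WeightedGraph Γ}

theorem ComparableToCounting.mu_pos (hμ : G.ComparableToCounting) (x : Γ) : 0 < G.mu x := by
  obtain ⟨C, hC, h⟩ := hμ
  exact lt_of_lt_of_le (by positivity) (h x).1

/-- As `μ` is bounded below, the supremum norm is controlled by the norm of `ℓ¹`. -/
theorem ComparableToCounting.exists_abs_le (hμ : G.ComparableToCounting) :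
    ∃ C, 0 < C ∧ ∀ f : Γ → ℝ, G.MemL1 f → ∀ x, |f x| ≤ C * G.l1Norm f := by
  obtain ⟨C, hC, h⟩ := id hμ
  refine ⟨C, by linarith, fun f hf x => ?_⟩
  have h1 : |f x| * G.mu x ≤ G.l1Norm f :=
    hf.le_tsum x fun y _ => mul_nonneg (abs_nonneg _) (hμ.mu_pos y).le
  have h2 : |f x| * C⁻¹ ≤ G.l1Norm f :=
    (mul_le_mul_of_nonneg_left (h x).1 (abs_nonneg _)).trans h1
  rw [← div_eq_mul_inv, div_le_iff₀ (by positivity)] at h2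
  linarith

theorem MemL1.exists_bound (hμ : G.ComparableToCounting) {f : Γ → ℝ} (hf : G.MemL1 f) :
    ∃ B, ∀ x, |f x| ≤ B :=
  let ⟨C, _, h⟩ := hμ.exists_abs_le
  ⟨C * G.l1Norm f, h f hf⟩

theorem MemL1.of_abs_le (hμ : G.ComparableToCounting) {f g : Γ → ℝ} {B : ℝ} (hf : G.MemL1 f)
    (h : ∀ x, |g x| ≤ B * |f x|) : G.MemL1 g := by
  refine Summable.of_nonneg_of_le (fun x => mul_nonneg (abs_nonneg _) (hμ.mu_pos x).le)
    (fun x => ?_) (hf.mul_left B)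
  rw [← mul_assoc]
  exact mul_le_mul_of_nonneg_right (h x) (hμ.mu_pos x).le

theorem MemL1.mul_bounded (hμ : G.ComparableToCounting) {f g : Γ → ℝ} {B : ℝ} (hf : G.MemL1 f)
    (hg : ∀ x, |g x| ≤ B) : G.MemL1 fun x => f x * g x :=
  hf.of_abs_le hμ (B := B) fun x => by
    rw [abs_mul, mul_comm]; exact mul_le_mul_of_nonneg_right (hg x) (abs_nonneg _)

theorem MemL1.mul (hμ : G.ComparableToCounting) {f g : Γ → ℝ} (hf : G.MemL1 f) (hg : G.MemL1 g) :
    G.MemL1 fun x => f x * g x :=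
  let ⟨_, hB⟩ := hg.exists_bound hμ
  hf.mul_bounded hμ hB

theorem MemL1.sq (hμ : G.ComparableToCounting) {f : Γ → ℝ} (hf : G.MemL1 f) :
    G.MemL1 fun x => f x ^ 2 := by
  simpa only [pow_two] using hf.mul hμ hf

theorem MemL1.summable (hμ : G.ComparableToCounting) {f : Γ → ℝ} (hf : G.MemL1 f) :
    Summable fun x => f x * G.mu x :=
  Summable.of_norm <| by
    simp only [Real.norm_eq_abs, abs_mul, abs_of_pos (hμ.mu_pos _)]
    exact hf

theorem MemL1.innerProd_self_le (hμ : G.ComparableToCounting) {f : Γ → ℝ} (hf : G.MemL1 f) {B : ℝ}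
    (hB : ∀ x, |f x| ≤ B) : G.innerProd f f ≤ B * G.l1Norm f := by
  refine hasSum_le (fun x => ?_) ((hf.mul hμ hf).summable hμ).hasSum (hf.hasSum.mul_left B)
  rw [← abs_mul_abs_self (f x), mul_assoc]
  exact mul_le_mul_of_nonneg_right (hB x) (mul_nonneg (abs_nonneg _) (hμ.mu_pos x).le)

/-- A Markov matrix for which `μ` is an invariant measure. -/
structure IsInvariantMarkov (G : WeightedGraph Γ) (q : Γ → Γ → ℝ) : Prop where
  nonneg : ∀ x y, 0 ≤ q x y
  hasSum_one : ∀ x, HasSum (q x) 1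
  memL1 : ∀ f, G.MemL1 f → G.MemL1 (matrixOp q f)
  invariant : ∀ f, G.MemL1 f → ∑' x, matrixOp q f x * G.mu x = ∑' x, f x * G.mu x

/-- A Markov matrix which satisfies the detailed balance equations with respect to `μ`. -/
structure IsReversibleMarkov (G : WeightedGraph Γ) (q : Γ → Γ → ℝ) : Prop where
  nonneg : ∀ x y, 0 ≤ q x y
  hasSum_one : ∀ x, HasSum (q x) 1
  balance : ∀ x y, G.mu x * q x y = G.mu y * q y x

section Reversible

variable (hμ : G.ComparableToCounting) {q : Γ → Γ → ℝ}

include hμ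

theorem IsReversibleMarkov.summable_pairing (hq : G.IsReversibleMarkov q) {f g : Γ → ℝ} {B : ℝ}
    (hf : G.MemL1 f) (hg : ∀ x, |g x| ≤ B) :
    Summable fun p : Γ × Γ => G.mu p.1 * q p.1 p.2 * (f p.1 * g p.2) := by
  have hbase : Summable fun p : Γ × Γ => (|f p.1| * G.mu p.1) * q p.1 p.2 := by
    have hnn : 0 ≤ fun p : Γ × Γ => (|f p.1| * G.mu p.1) * q p.1 p.2 := fun p =>
      mul_nonneg (mul_nonneg (abs_nonneg _) (hμ.mu_pos _).le) (hq.nonneg _ _)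
    refine (summable_prod_of_nonneg hnn).2 ⟨fun x => ?_, ?_⟩
    · exact (hq.hasSum_one x).summable.mul_left (|f x| * G.mu x)
    simp only [tsum_mul_left, (hq.hasSum_one _).tsum_eq, mul_one]
    exact hf
  refine Summable.of_norm_bounded (hbase.mul_right B) fun p => ?_
  rw [Real.norm_eq_abs, abs_mul, abs_mul, abs_mul, abs_of_pos (hμ.mu_pos _),
    abs_of_nonneg (hq.nonneg _ _)]
  have := mul_le_mul_of_nonneg_left (hg p.2) (mul_nonneg (mul_nonneg (abs_nonneg (f p.1))
    (hμ.mu_pos p.1).le) (hq.nonneg p.1 p.2))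
  linarith

/-- Reversible Markov operators are symmetric. -/
theorem IsReversibleMarkov.hasSum_pairing (hq : G.IsReversibleMarkov q) {f g : Γ → ℝ} {B : ℝ}
    (hf : G.MemL1 f) (hg : ∀ x, |g x| ≤ B) :
    HasSum (fun x => matrixOp q f x * g x * G.mu x) (∑' x, f x * matrixOp q g x * G.mu x) := by
  have hF := hq.summable_pairing hμ hf hg
  have h1 : ∑' x, f x * matrixOp q g x * G.mu x =
      ∑' p : Γ × Γ, G.mu p.1 * q p.1 p.2 * (f p.1 * g p.2) := by
    rw [hF.tsum_prod]
    refine tsum_congr fun x => ?_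
    rw [matrixOp, ← tsum_mul_left, ← tsum_mul_right]
    exact tsum_congr fun y => by ring
  rw [h1]
  have h2 := hF.prod_symm.hasSum.prod_fiberwise (fun y => (hF.prod_symm.prod_factor y).hasSum)
  convert h2 using 1
  · funext y
    rw [matrixOp, ← tsum_mul_right, ← tsum_mul_right]
    refine tsum_congr fun x => ?_
    simp only [Prod.swap_prod_mk, hq.balance x y]
    ring
  · exact ((Equiv.prodComm Γ Γ).tsum_eq
      fun p : Γ × Γ => G.mu p.1 * q p.1 p.2 * (f p.1 * g p.2)).symm

theorem IsReversibleMarkov.isInvariantMarkov (hq : G.IsReversibleMarkov q) :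
    G.IsInvariantMarkov q where
  nonneg := hq.nonneg
  hasSum_one := hq.hasSum_one
  memL1 f hf := by
    have habs : G.MemL1 fun x => |f x| := by simpa [MemL1] using hf
    have h := (hq.hasSum_pairing hμ habs (g := fun _ => 1) (B := 1) (by simp)).summable
    refine Summable.of_nonneg_of_le (fun x => mul_nonneg (abs_nonneg _) (hμ.mu_pos x).le)
      (fun x => ?_) h
    rw [mul_one]
    refine mul_le_mul_of_nonneg_right ?_ (hμ.mu_pos x).le
    obtain ⟨B, hB⟩ := hf.exists_bound hμ
    exact abs_matrixOp_le hq.nonneg hq.hasSum_one hB x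
  invariant f hf := by
    have h := (hq.hasSum_pairing hμ hf (g := fun _ => 1) (B := 1) (by simp)).tsum_eq
    simpa [matrixOp, (hq.hasSum_one _).tsum_eq] using h

/-- The square of a reversible Markov operator: `⟨Q (Q f), f⟩ = ‖Q f‖²`. -/
theorem IsReversibleMarkov.innerProd_sq (hq : G.IsReversibleMarkov q) {f : Γ → ℝ}
    (hf : G.MemL1 f) :
    G.innerProd (matrixOp q (matrixOp q f)) f = G.innerProd (matrixOp q f) (matrixOp q f) := by
  obtain ⟨B, hB⟩ := hf.exists_bound hμ
  exact (hq.hasSum_pairing hμ ((hq.isInvariantMarkov hμ).memL1 f hf) hB).tsum_eq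

end Reversible

/-! ### Energies of Markov matrices -/

/-- The energy `∑_x ∑_y q(x, y) (f(y) - f(x))² μ(x)`. -/
noncomputable def energy (G : WeightedGraph Γ) (q : Γ → Γ → ℝ) (f : Γ → ℝ) : ℝ :=
  ∑' x, (∑' y, q x y * (f y - f x) ^ 2) * G.mu x

section Energy

variable (hμ : G.ComparableToCounting) {q : Γ → Γ → ℝ}

include hμ

theorem IsInvariantMarkov.summable_energy (hq : G.IsInvariantMarkov q) {f : Γ → ℝ}
    (hf : G.MemL1 f) : Summable fun x => (∑' y, q x y * (f y - f x) ^ 2) * G.mu x := by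
  obtain ⟨B, hB⟩ := hf.exists_bound hμ
  have h1 := (hq.memL1 _ (hf.sq hμ)).summable hμ
  have h2 := (hf.mul hμ (hq.memL1 _ hf)).summable hμ
  have h3 := (hf.sq hμ).summable hμ
  refine ((h1.sub (h2.mul_left 2)).add h3).congr fun x => ?_
  rw [(hasSum_weight_mul_sub_sq (hq.nonneg x) (hq.hasSum_one x) hB (f x)).tsum_eq]
  simp only [matrixOp]
  ring

/-- The loss of `ℓ²` norm is the integral of the variances of `f` under the transition
probabilities. -/
theorem IsInvariantMarkov.hasSum_variance (hq : G.IsInvariantMarkov q) {f : Γ → ℝ}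
    (hf : G.MemL1 f) :
    HasSum (fun x => (∑' y, q x y * f y ^ 2 - (∑' y, q x y * f y) ^ 2) * G.mu x)
      (G.innerProd f f - G.innerProd (matrixOp q f) (matrixOp q f)) := by
  have h1 := ((hq.memL1 _ (hf.sq hμ)).summable hμ).hasSum
  have h2 := (((hq.memL1 _ hf).mul hμ (hq.memL1 _ hf)).summable hμ).hasSum
  rw [hq.invariant _ (hf.sq hμ)] at h1
  convert h1.sub h2 using 1
  · rfl
  · funext x; simp only [matrixOp]; ring
  · simp only [innerProd, pow_two]

theorem IsInvariantMarkov.innerProd_le (hq : G.IsInvariantMarkov q) {f : Γ → ℝ}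
    (hf : G.MemL1 f) : G.innerProd (matrixOp q f) (matrixOp q f) ≤ G.innerProd f f := by
  obtain ⟨B, hB⟩ := hf.exists_bound hμ
  refine sub_nonneg.1 ((hq.hasSum_variance hμ hf).nonneg fun x =>
    mul_nonneg ?_ (hμ.mu_pos x).le)
  have h := (hasSum_weight_mul_sub_sq (hq.nonneg x) (hq.hasSum_one x) hB
    (∑' y, q x y * f y)).nonneg fun y => mul_nonneg (hq.nonneg x y) (sq_nonneg _)
  linarith

theorem IsInvariantMarkov.innerProd_sub_le_energy (hq : G.IsInvariantMarkov q) {f : Γ → ℝ}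
    (hf : G.MemL1 f) :
    G.innerProd f f - G.innerProd (matrixOp q f) (matrixOp q f) ≤ G.energy q f := by
  obtain ⟨B, hB⟩ := hf.exists_bound hμ
  refine hasSum_le (fun x => ?_) (hq.hasSum_variance hμ hf) (hq.summable_energy hμ hf).hasSum
  exact mul_le_mul_of_nonneg_right
    (variance_le_tsum_sub_sq (hq.nonneg x) (hq.hasSum_one x) hB (f x)) (hμ.mu_pos x).le

/-- If the walk stays where it is with probability at least `ε`, then its energy is controlled by
that of its square. -/
theorem IsInvariantMarkov.energy_le_of_lazy (hq : G.IsInvariantMarkov q) {f : Γ → ℝ} {ε : ℝ}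
    (hε : 0 < ε) (hlazy : ∀ x, ε ≤ q x x) (hf : G.MemL1 f) :
    G.energy q f ≤
      (1 + ε⁻¹) * (G.innerProd f f - G.innerProd (matrixOp q f) (matrixOp q f)) := by
  obtain ⟨B, hB⟩ := hf.exists_bound hμ
  refine hasSum_le (fun x => ?_) (hq.summable_energy hμ hf).hasSum
    ((hq.hasSum_variance hμ hf).mul_left _)
  rw [← mul_assoc]
  exact mul_le_mul_of_nonneg_right
    (tsum_sub_sq_le_variance (hq.nonneg x) (hq.hasSum_one x) hB hε (hlazy x)) (hμ.mu_pos x).le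

/-- A pointwise bound for a combination of matrices gives a bound for the energies. -/
theorem sum_energy_le_of_sum_le {ι : Type*} {s : Finset ι} {c : ι → ℝ} {p : ι → Γ → Γ → ℝ}
    {A : ℝ} (hp : ∀ i, G.IsInvariantMarkov (p i)) (hq : G.IsInvariantMarkov q)
    (h : ∀ x y, ∑ i ∈ s, c i * p i x y ≤ A * q x y) {f : Γ → ℝ} (hf : G.MemL1 f) :
    ∑ i ∈ s, c i * G.energy (p i) f ≤ A * G.energy q f := by
  obtain ⟨B, hB⟩ := hf.exists_bound hμ
  refine hasSum_le (fun x => ?_)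
    (hasSum_sum fun i _ => ((hp i).summable_energy hμ hf).hasSum.mul_left (c i))
    ((hq.summable_energy hμ hf).hasSum.mul_left A)
  have hsum : ∀ r : Γ → Γ → ℝ, G.IsInvariantMarkov r →
      Summable fun y => r x y * (f y - f x) ^ 2 := fun r hr =>
    (hasSum_weight_mul_sub_sq (hr.nonneg x) (hr.hasSum_one x) hB (f x)).summable
  have hx : ∑ i ∈ s, c i * ∑' y, p i x y * (f y - f x) ^ 2 ≤
      A * ∑' y, q x y * (f y - f x) ^ 2 := by
    refine hasSum_le (fun y => ?_)
      (hasSum_sum fun i _ => (hsum _ (hp i)).hasSum.mul_left (c i)) ((hsum _ hq).hasSum.mul_left A)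
    have := mul_le_mul_of_nonneg_right (h x y) (sq_nonneg (f y - f x))
    rw [Finset.sum_mul] at this
    simpa only [mul_assoc] using this
  have := mul_le_mul_of_nonneg_right hx (hμ.mu_pos x).le
  rw [Finset.sum_mul] at this
  simpa only [mul_assoc] using this

theorem energy_nonneg (hq : G.IsInvariantMarkov q) (f : Γ → ℝ) : 0 ≤ G.energy q f :=
  tsum_nonneg fun x => mul_nonneg
    (tsum_nonneg fun y => mul_nonneg (hq.nonneg x y) (sq_nonneg _)) (hμ.mu_pos x).le

theorem IsInvariantMarkov.l1Norm_le (hq : G.IsInvariantMarkov q) {f : Γ → ℝ} (hf : G.MemL1 f) :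
    G.l1Norm (matrixOp q f) ≤ G.l1Norm f := by
  have habs : G.MemL1 fun x => |f x| := by simpa [MemL1] using hf
  have hinv := hq.invariant _ habs
  rw [l1Norm, l1Norm, ← hinv]
  refine hasSum_le (fun x => ?_) (hq.memL1 f hf).hasSum
    ((hq.memL1 _ habs).summable hμ).hasSum
  refine mul_le_mul_of_nonneg_right ?_ (hμ.mu_pos x).le
  obtain ⟨B, hB⟩ := hf.exists_bound hμ
  exact abs_matrixOp_le hq.nonneg hq.hasSum_one hB x

end Energy

/-! ### The natural random walk -/

section Walk

theorem matrixOp_Pn_zero (f : Γ → ℝ) : matrixOp (G.Pn 0) f = f := by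
  classical
  funext x
  rw [matrixOp, tsum_eq_single x]
  · simp [Pn]
  · intro y hy
    simp [Pn, hy.symm]

variable (hμ : G.ComparableToCounting)

include hμ

theorem isReversibleMarkov_P : G.IsReversibleMarkov G.P where
  nonneg x y := div_nonneg (G.weight_nonneg x y) (hμ.mu_pos x).le
  hasSum_one x := by
    have hfin : (Function.support (G.weight x)).Finite :=
      (G.locallyFinite x).subset fun y hy =>
        lt_of_le_of_ne (G.weight_nonneg x y) (Ne.symm hy)
    have h : HasSum (G.weight x) (G.mu x) := (summable_of_hasFiniteSupport hfin).hasSum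
    have h' := h.div_const (G.mu x)
    rwa [div_self (hμ.mu_pos x).ne'] at h'
  balance x y := by
    simp only [P]
    rw [mul_div_cancel₀ _ (hμ.mu_pos x).ne', mul_div_cancel₀ _ (hμ.mu_pos y).ne', G.weight_symm]

theorem Pn_nonneg_hasSum (n : ℕ) :
    (∀ x y, 0 ≤ G.Pn n x y) ∧ ∀ x, HasSum (G.Pn n x) 1 := by
  have hP := isReversibleMarkov_P hμ
  induction n with
  | zero =>
    classical
    refine ⟨fun x y => by simp only [Pn]; positivity, fun x => ?_⟩
    simpa only [Pn, eq_comm] using hasSum_ite_eq x (1 : ℝ)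
  | succ n ih =>
    refine ⟨fun x y => tsum_nonneg fun z => mul_nonneg (hP.nonneg _ _) (ih.1 _ _), fun x => ?_⟩
    have h := matrixOp_comp (f := fun _ => (1 : ℝ)) (B := 1) hP.nonneg hP.hasSum_one ih.1 ih.2
      (by simp) x
    simpa [matrixOp, (ih.2 _).tsum_eq, (hP.hasSum_one _).tsum_eq, Pn] using h

theorem matrixOp_Pn_succ (n : ℕ) {f : Γ → ℝ} (hf : G.MemL1 f) :
    matrixOp (G.Pn (n + 1)) f = matrixOp G.P (matrixOp (G.Pn n) f) := by
  have hP := isReversibleMarkov_P hμ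
  obtain ⟨B, hB⟩ := hf.exists_bound hμ
  have ih := Pn_nonneg_hasSum hμ n
  funext x
  exact (matrixOp_comp hP.nonneg hP.hasSum_one ih.1 ih.2 hB x).tsum_eq

theorem isInvariantMarkov_Pn (n : ℕ) : G.IsInvariantMarkov (G.Pn n) where
  nonneg := (Pn_nonneg_hasSum hμ n).1
  hasSum_one := (Pn_nonneg_hasSum hμ n).2
  memL1 f hf := by
    induction n with
    | zero => rwa [matrixOp_Pn_zero]
    | succ n ih =>
      rw [matrixOp_Pn_succ hμ n hf]
      exact ((isReversibleMarkov_P hμ).isInvariantMarkov hμ).memL1 _ ih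
  invariant f hf := by
    suffices h : G.MemL1 (matrixOp (G.Pn n) f) ∧
        ∑' x, matrixOp (G.Pn n) f x * G.mu x = ∑' x, f x * G.mu x from h.2
    induction n with
    | zero => rw [matrixOp_Pn_zero]; exact ⟨hf, rfl⟩
    | succ n ih =>
      have hP := (isReversibleMarkov_P hμ).isInvariantMarkov hμ
      rw [matrixOp_Pn_succ hμ n hf]
      exact ⟨hP.memL1 _ ih.1, (hP.invariant _ ih.1).trans ih.2⟩

/-- The sequence `n ↦ ‖Pⁿ f‖²` is convex: for `g = Pⁿ f`, its second difference is
`‖g - P² g‖²`. -/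
theorem innerProd_Pn_convex {f : Γ → ℝ} (hf : G.MemL1 f) (n : ℕ) :
    2 * G.innerProd (matrixOp (G.Pn (n + 1)) f) (matrixOp (G.Pn (n + 1)) f) ≤
      G.innerProd (matrixOp (G.Pn n) f) (matrixOp (G.Pn n) f) +
      G.innerProd (matrixOp (G.Pn (n + 2)) f) (matrixOp (G.Pn (n + 2)) f) := by
  have hP := isReversibleMarkov_P hμ
  have hPi := hP.isInvariantMarkov hμ
  rw [matrixOp_Pn_succ hμ (n + 1) hf, matrixOp_Pn_succ hμ n hf]
  set g := matrixOp (G.Pn n) f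
  have hg : G.MemL1 g := (isInvariantMarkov_Pn hμ n).memL1 f hf
  rw [← hP.innerProd_sq hμ hg]
  have hg2 := hPi.memL1 _ (hPi.memL1 _ hg)
  set h := matrixOp G.P (matrixOp G.P g)
  have h1 := ((hg2.mul hμ hg).summable hμ).hasSum.mul_left 2
  have h2 := ((hg.mul hμ hg).summable hμ).hasSum.add ((hg2.mul hμ hg2).summable hμ).hasSum
  refine hasSum_le (fun x => ?_) h1 h2
  nlinarith [mul_nonneg (sq_nonneg (g x - h x)) (hμ.mu_pos x).le]

/-- A uniform bound for the heat kernel is a bound for `Pⁿ` from `ℓ¹` to `ℓ²`. -/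
theorem innerProd_Pn_le_of_heatKernel_le {n : ℕ} {S : ℝ} (hS : ∀ x y, G.heatKernel n x y ≤ S)
    {f : Γ → ℝ} (hf : G.MemL1 f) :
    G.innerProd (matrixOp (G.Pn n) f) (matrixOp (G.Pn n) f) ≤ S * G.l1Norm f ^ 2 := by
  have hn := isInvariantMarkov_Pn hμ n
  have hle : ∀ x y, G.Pn n x y ≤ S * G.mu y := fun x y => (div_le_iff₀ (hμ.mu_pos y)).1 (hS x y)
  have hsup : ∀ x, |matrixOp (G.Pn n) f x| ≤ S * G.l1Norm f := fun x => by
    refine tsum_of_norm_bounded (E := ℝ) (hf.hasSum.mul_left S) fun y => ?_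
    rw [Real.norm_eq_abs, abs_mul, abs_of_nonneg (hn.nonneg x y)]
    nlinarith [mul_le_mul_of_nonneg_right (hle x y) (abs_nonneg (f y))]
  refine ((hn.memL1 f hf).innerProd_self_le hμ hsup).trans ?_
  rcases isEmpty_or_nonempty Γ with h | ⟨⟨x⟩⟩
  · simp [l1Norm]
  · have h0 : 0 ≤ S * G.l1Norm f := (abs_nonneg _).trans (hsup x)
    nlinarith [mul_le_mul_of_nonneg_left (hn.l1Norm_le hμ hf) h0]

end Walk

end WeightedGraph

/-- For a convex sequence the mean rate of decrease is non-increasing. -/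
theorem mul_sub_le_mul_sub_of_convex {b : ℕ → ℝ} (hb : ∀ n, 2 * b (n + 1) ≤ b n + b (n + 2))
    {n m : ℕ} (h : n ≤ m) : (n : ℝ) * (b 0 - b m) ≤ m * (b 0 - b n) := by
  have hinc : ∀ n : ℕ, (n : ℝ) * (b n - b (n + 1)) ≤ b 0 - b n := by
    intro n
    induction n with
    | zero => simp
    | succ n ih =>
      have := mul_le_mul_of_nonneg_left (hb n) (show (0 : ℝ) ≤ n + 1 by positivity)
      push_cast
      nlinarith
  induction m, h using Nat.le_induction with
  | base => exact le_rfl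
  | succ m hm ih =>
    rcases Nat.eq_zero_or_pos n with rfl | hn
    · simp
    have h1 := hinc m
    have hm0 : (0 : ℝ) < m := by exact_mod_cast hn.trans_le hm
    have hn0 : (0 : ℝ) < n := by exact_mod_cast hn
    push_cast
    have h2 := mul_le_mul_of_nonneg_left h1 hn0.le
    have h3 : (m : ℝ) * (n * (b 0 - b (m + 1))) ≤ m * ((m + 1) * (b 0 - b n)) := by
      nlinarith
    exact le_of_mul_le_mul_left h3 hm0

/-! ### Regularly varying functions -/

/-- A continuous function whose increments `h (u + a) - h u` are bounded for large `u`, for each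
fixed `a`, has bounded oscillation on unit intervals far out. By Baire's theorem the bound is
uniform over some interval of values of `a`; differences of such increments give all small
increments, and chains of these all increments of length at most one. -/
theorem exists_bound_increments {h : ℝ → ℝ} (hc : Continuous h)
    (hb : ∀ a, ∃ K, ∀ u, K ≤ u → |h (u + a) - h u| ≤ K) :
    ∃ L N : ℝ, ∀ u w, N ≤ u → 0 ≤ w → w ≤ 1 → |h (u + w) - h u| ≤ L := by
  let F : ℕ → Set ℝ := fun n => {a | ∀ u, (n : ℝ) ≤ u → |h (u + a) - h u| ≤ n}
  have hF : ∀ n, IsClosed (F n) := fun n => by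
    rw [show F n = ⋂ u, ⋂ _ : (n : ℝ) ≤ u, {a | |h (u + a) - h u| ≤ n} by ext; simp [F]]
    refine isClosed_iInter fun u => isClosed_iInter fun _ => isClosed_le ?_ continuous_const
    fun_prop
  have hU : ⋃ n, F n = univ := by
    refine eq_univ_of_forall fun a => ?_
    obtain ⟨K, hK⟩ := hb a
    obtain ⟨n, hn⟩ := exists_nat_ge K
    exact mem_iUnion.2 ⟨n, fun u hu => (hK u (hn.trans hu)).trans hn⟩
  obtain ⟨n, a, ha⟩ := nonempty_interior_of_iUnion_of_closed hF hU
  obtain ⟨ε, hε, hball⟩ := Metric.isOpen_iff.1 isOpen_interior a ha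
  have hmem : ∀ w, |w| < ε → a + w ∈ F n := fun w hw =>
    interior_subset (hball (by simpa [Real.dist_eq] using hw))
  have hsmall : ∀ u w, (n : ℝ) + a ≤ u → |w| < ε → |h (u + w) - h u| ≤ 2 * n := by
    intro u w hu hw
    have h1 := hmem w hw (u - a) (by linarith)
    have h2 := hmem 0 (by simpa using hε) (u - a) (by linarith)
    rw [show u - a + (a + w) = u + w by ring] at h1
    rw [show u - a + (a + 0) = u by ring] at h2
    rw [abs_le] at *
    constructor <;> linarith
  obtain ⟨k, hk⟩ := exists_nat_gt ε⁻¹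
  have hk0 : (0 : ℝ) < k := (inv_pos.2 hε).trans hk
  refine ⟨k * (2 * n), n + a, fun u w hu hw hw1 => ?_⟩
  have hstep : ∀ i : ℕ, |h (u + i * (w / k)) - h u| ≤ i * (2 * n) := by
    intro i
    induction i with
    | zero => simp
    | succ i ih =>
      have hwk : 0 ≤ w / k := by positivity
      have h1 := hsmall (u + i * (w / k)) (w / k) (by nlinarith [mul_nonneg i.cast_nonneg hwk]) (by
        rw [abs_of_nonneg hwk, div_lt_iff₀ hk0]
        rw [inv_lt_iff_one_lt_mul₀ hε] at hk
        linarith)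
      rw [show u + i * (w / k) + w / k = u + ((i + 1 : ℕ) : ℝ) * (w / k) by push_cast; ring] at h1
      push_cast at h1 ⊢
      rw [abs_le] at *
      constructor <;> linarith
  have := hstep k
  rwa [mul_div_cancel₀ _ hk0.ne'] at this

/-- A continuous regularly varying function with values in `[1, ∞)` takes comparable values at
comparable points; points of `[0, 2]` count as comparable. -/
theorem RegularlyVarying.exists_le_mul {φ : ℝ → ℝ} {β : ℝ} (hcont : ContinuousOn φ (Ici 0))
    (hone : ∀ t, 0 ≤ t → 1 ≤ φ t) (hrv : RegularlyVarying φ β) :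
    ∃ M, 1 ≤ M ∧ ∀ s t, 0 ≤ s → 0 ≤ t → s ≤ 2 * max t 1 → t ≤ 2 * max s 1 → φ s ≤ M * φ t := by
  have hpos : ∀ t, 0 ≤ t → 0 < φ t := fun t ht => one_pos.trans_le (hone t ht)
  let h : ℝ → ℝ := fun u => Real.log (φ (Real.exp u))
  have hc : Continuous h := by
    refine Continuous.log ?_ fun u => (hpos _ (Real.exp_pos u).le).ne'
    exact hcont.comp_continuous Real.continuous_exp fun u => (Real.exp_pos u).le
  have hb : ∀ a, ∃ K, ∀ u, K ≤ u → |h (u + a) - h u| ≤ K := by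
    intro a
    have h1 := (hrv (Real.exp a) (Real.exp_pos a)).comp Real.tendsto_exp_atTop
    have h2 := (h1.log (Real.rpow_pos_of_pos (Real.exp_pos a) β).ne').abs
    obtain ⟨N, hN⟩ := eventually_atTop.1 (h2.eventually_le_const (lt_add_one _))
    refine ⟨max N (|Real.log (Real.exp a ^ β)| + 1), fun u hu => ?_⟩
    refine le_trans ?_ ((hN u ((le_max_left _ _).trans hu)).trans (le_max_right _ _))
    simp only [h, Function.comp]
    rw [Real.log_div (hpos _ (by positivity)).ne' (hpos _ (by positivity)).ne', ← Real.exp_add,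
      add_comm a u]
  obtain ⟨L, N, hL⟩ := exists_bound_increments hc hb
  -- the comparison beyond `T`, where the bound on logarithmic increments is available
  let T : ℝ := max (Real.exp N) 1
  have hT : ∀ s t, T ≤ s → s ≤ t → t ≤ 2 * s →
      φ s ≤ Real.exp L * φ t ∧ φ t ≤ Real.exp L * φ s := by
    intro s t hs hst hts
    have hs0 : 0 < s := (Real.exp_pos N).trans_le ((le_max_left _ _).trans hs)
    have ht0 : 0 < t := hs0.trans_le hst
    have hw0 : 0 ≤ Real.log t - Real.log s := sub_nonneg.2 (Real.log_le_log hs0 hst)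
    have hw1 : Real.log t - Real.log s ≤ 1 := by
      rw [← Real.log_div ht0.ne' hs0.ne']
      have h2 : t / s ≤ 2 := (div_le_iff₀ hs0).2 hts
      have := Real.log_le_sub_one_of_pos (div_pos ht0 hs0)
      linarith
    have hN : N ≤ Real.log s := (Real.le_log_iff_exp_le hs0).2 ((le_max_left _ _).trans hs)
    have := hL (Real.log s) (Real.log t - Real.log s) hN hw0 hw1
    simp only [h, add_sub_cancel, Real.exp_log hs0, Real.exp_log ht0] at this
    rw [abs_le] at this
    have hφs := hpos s hs0.le
    have hφt := hpos t ht0.le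
    constructor
    · rw [← Real.log_le_log_iff hφs (by positivity), Real.log_mul (by positivity) hφt.ne',
        Real.log_exp]
      linarith
    · rw [← Real.log_le_log_iff hφt (by positivity), Real.log_mul (by positivity) hφs.ne',
        Real.log_exp]
      linarith
  obtain ⟨D, hD⟩ := (isCompact_Icc (a := (0 : ℝ)) (b := 2 * T)).bddAbove_image
    (hcont.mono Icc_subset_Ici_self)
  refine ⟨max 1 (max D (Real.exp L)), le_max_left _ _, fun s t hs ht hst hts => ?_⟩
  have hMle : ∀ c, c ≤ max 1 (max D (Real.exp L)) → φ s ≤ c * φ t →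
      φ s ≤ max 1 (max D (Real.exp L)) * φ t := fun c hc h =>
    h.trans (mul_le_mul_of_nonneg_right hc (hpos t ht).le)
  have hT1 : 1 ≤ T := le_max_right _ _
  rcases le_total s t with h' | h'
  · rcases le_total T s with hTs | hTs
    · refine hMle _ ((le_max_right _ _).trans (le_max_right _ _)) (hT s t hTs h' ?_).1
      rwa [max_eq_left (hT1.trans hTs)] at hts
    · have hs2 : φ s ≤ D := hD ⟨s, ⟨hs, by linarith⟩, rfl⟩
      have hD0 : 0 ≤ D := (hpos s hs).le.trans hs2
      exact hMle D ((le_max_left _ _).trans (le_max_right _ _))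
        (by nlinarith [hone t ht])
  · rcases le_total T t with hTt | hTt
    · refine hMle _ ((le_max_right _ _).trans (le_max_right _ _)) (hT t s hTt h' ?_).2
      rwa [max_eq_left (hT1.trans hTt)] at hst
    · have hs2 : φ s ≤ D := hD ⟨s, ⟨hs, hst.trans (by
        have := max_le hTt hT1
        linarith)⟩, rfl⟩
      have hD0 : 0 ≤ D := (hpos s hs).le.trans hs2
      exact hMle D ((le_max_left _ _).trans (le_max_right _ _))
        (by nlinarith [hone t ht])

/-- A positive sequence which is eventually non-decreasing is non-decreasing up to a constant. -/
theorem exists_le_mul_of_eventually_monotone {b : ℕ → ℝ} (hb : ∀ i, 0 < b i) (i₀ : ℕ)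
    (h : ∀ i, i₀ ≤ i → b i ≤ b (i + 1)) : ∃ c, 1 ≤ c ∧ ∀ i l, b i ≤ c * b (i + l) := by
  suffices H : ∀ n, n ≤ i₀ → ∃ c, 1 ≤ c ∧ ∀ i, i₀ ≤ i + n → ∀ l, b i ≤ c * b (i + l) by
    obtain ⟨c, hc, h'⟩ := H i₀ le_rfl
    exact ⟨c, hc, fun i l => h' i (by omega) l⟩
  intro n hn
  induction n with
  | zero =>
    refine ⟨1, le_rfl, fun i hi l => ?_⟩
    rw [one_mul]
    induction l with
    | zero => rfl
    | succ l ih => exact ih.trans (h _ (by omega))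
  | succ n ih =>
    obtain ⟨c, hc, h'⟩ := ih (by omega)
    have hc0 : 0 < c := by linarith
    refine ⟨max c (Finset.sup' (Finset.range (i₀ + 1)) (by simp) fun i => b i / b (i + 1) * c),
      hc.trans (le_max_left _ _), fun i hi l => ?_⟩
    rcases Nat.lt_or_ge (i + n) i₀ with hlt | hge
    · cases l with
      | zero =>
        exact le_mul_of_one_le_left (hb _).le (hc.trans (le_max_left _ _))
      | succ l =>
        have h1 := h' (i + 1) (by omega) l
        rw [show i + 1 + l = i + (l + 1) by ring] at h1
        have h2 : b i ≤ b i / b (i + 1) * c * b (i + (l + 1)) := by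
          rw [mul_assoc, div_mul_eq_mul_div, le_div_iff₀ (hb _)]
          exact mul_le_mul_of_nonneg_left h1 (hb i).le
        refine h2.trans (mul_le_mul_of_nonneg_right (le_max_of_le_right ?_) (hb _).le)
        exact Finset.le_sup' (fun i => b i / b (i + 1) * c) (by simp; omega)
    · exact (h' i hge l).trans (mul_le_mul_of_nonneg_right (le_max_left _ _) (hb _).le)

/-- A regularly varying function of positive index grows at least geometrically along the powers
of two. -/
theorem RegularlyVarying.exists_geometric_growth {φ : ℝ → ℝ} {β : ℝ}
    (hone : ∀ t, 0 ≤ t → 1 ≤ φ t) (hβ : 0 < β) (hrv : RegularlyVarying φ β) :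
    ∃ c θ : ℝ, 1 ≤ c ∧ 1 < θ ∧ ∀ i l : ℕ, φ (2 ^ i) * θ ^ l ≤ c * φ (2 ^ (i + l)) := by
  have hpos : ∀ i : ℕ, 0 < φ (2 ^ i) := fun i => one_pos.trans_le (hone _ (by positivity))
  obtain ⟨θ, hθ1, hθ⟩ := exists_between (Real.one_lt_rpow one_lt_two hβ)
  have hθ0 : 0 < θ := by linarith
  have h1 := (hrv 2 two_pos).comp (tendsto_pow_atTop_atTop_of_one_lt (one_lt_two (α := ℝ)))
  obtain ⟨i₀, hi₀⟩ := eventually_atTop.1 (h1.eventually_const_le hθ)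
  obtain ⟨c, hc, h⟩ := exists_le_mul_of_eventually_monotone (b := fun i => φ (2 ^ i) / θ ^ i)
    (fun i => div_pos (hpos i) (by positivity)) i₀ fun i hi => by
      have := hi₀ i hi
      simp only [Function.comp, ← pow_succ'] at this
      rw [le_div_iff₀ (hpos i)] at this
      rw [div_le_div_iff₀ (by positivity) (by positivity), pow_succ]
      nlinarith [pow_pos hθ0 i]
  refine ⟨c, θ, hc, hθ1, fun i l => ?_⟩
  have := h i l
  rw [div_le_iff₀ (by positivity), pow_add θ] at this
  have h3 : c * (φ (2 ^ (i + l)) / (θ ^ i * θ ^ l)) * θ ^ i = c * φ (2 ^ (i + l)) / θ ^ l := by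
    field_simp
  rw [h3, le_div_iff₀ (by positivity)] at this
  exact this

/-! ### Volume growth -/

namespace WeightedGraph

variable {Γ : Type*} {G : WeightedGraph Γ} {V : ℝ → ℝ}

theorem HasVolumeGrowth.mono (hV : G.HasVolumeGrowth V) {s t : ℝ} (hs : 0 ≤ s) (h : s ≤ t) :
    V s ≤ V t :=
  hV.strictMonoOn.monotoneOn hs (hs.trans h) h

/-- On an infinite graph `V` is unbounded: every finite set of vertices lies in some ball. -/
theorem HasVolumeGrowth.exists_ge [Infinite Γ] (hμ : G.ComparableToCounting)
    (hV : G.HasVolumeGrowth V) (K : ℝ) : ∃ r, 0 ≤ r ∧ K ≤ V r := by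
  obtain ⟨C, hC, hmu⟩ := id hμ
  obtain ⟨Ch, hCh, hvol⟩ := hV.homogeneous
  have hC0 : 0 < C := by linarith
  have hCh0 : 0 < Ch := by linarith
  obtain ⟨n, hn⟩ := exists_nat_ge (C * Ch * K)
  obtain ⟨S, hS⟩ := Infinite.exists_subset_card_eq Γ n
  obtain ⟨o⟩ : Nonempty Γ := inferInstance
  let r : ℝ := 1 + ∑ y ∈ S, G.d o y
  have hd : ∀ x y, 0 ≤ G.d x y := fun x y => Nat.cast_nonneg _
  have hr : 0 < r := add_pos_of_pos_of_nonneg one_pos (Finset.sum_nonneg fun y _ => hd o y)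
  refine ⟨r, hr.le, ?_⟩
  have hv := hvol o r hr
  have hvpos : 0 < G.vol o r := lt_of_lt_of_le (mul_pos (inv_pos.2 hCh0) (hV.pos r hr.le)) hv.1
  -- a divergent sum would have the value zero
  have hsum : Summable fun y : G.ball o r => G.mu y := by
    by_contra h
    rw [vol, tsum_eq_zero_of_not_summable h] at hvpos
    exact hvpos.false
  have hSball : ∀ y ∈ S, y ∈ G.ball o r := fun y hy => by
    have := Finset.single_le_sum (f := fun y => G.d o y) (fun y _ => hd o y) hy
    simp only [ball, mem_ofPred_eq, r]
    linarith
  classical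
  have h1 : ∑ y ∈ S.subtype (· ∈ G.ball o r), G.mu y ≤ G.vol o r :=
    hsum.sum_le_tsum _ fun y _ => (hμ.mu_pos y).le
  have h2 : (n : ℝ) * C⁻¹ ≤ ∑ y ∈ S.subtype (· ∈ G.ball o r), G.mu y := by
    rw [Finset.sum_subtype_of_mem (fun y => G.mu y) hSball, ← hS, ← nsmul_eq_mul]
    exact Finset.card_nsmul_le_sum _ _ _ fun y _ => (hmu y).1
  have h3 : (n : ℝ) * C⁻¹ ≤ Ch * V r := h2.trans (h1.trans hv.2)
  rw [← div_eq_mul_inv, div_le_iff₀ hC0] at h3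
  have h4 : C * Ch * K ≤ C * Ch * V r := by linarith
  exact le_of_mul_le_mul_left h4 (by positivity)

theorem HasVolumeGrowth.mem_image [Infinite Γ] (hμ : G.ComparableToCounting)
    (hV : G.HasVolumeGrowth V) {K : ℝ} (hK : V 0 ≤ K) : K ∈ V '' Ici 0 := by
  obtain ⟨r, hr, hKr⟩ := hV.exists_ge hμ K
  obtain ⟨s, hs, hsK⟩ := intermediate_value_Icc hr (hV.continuousOn.mono Icc_subset_Ici_self)
    ⟨hK, hKr⟩
  exact ⟨s, hs.1, hsK⟩

end WeightedGraph

/-! ### Sums over dyadic scales -/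

/-- The number of steps `⌈(2ʲ)^γ⌉` which the walk typically takes to leave a ball of radius `2ʲ`. -/
noncomputable def scaleTime (γ : ℝ) (j : ℕ) : ℕ := ⌈((2 : ℝ) ^ j) ^ γ⌉₊

theorem le_scaleTime (γ : ℝ) (j : ℕ) : ((2 : ℝ) ^ j) ^ γ ≤ scaleTime γ j := Nat.le_ceil _

section ScaleTime

variable {γ : ℝ} (hγ : 1 < γ)

include hγ

theorem one_le_two_pow_rpow (j : ℕ) : 1 ≤ ((2 : ℝ) ^ j) ^ γ :=
  Real.one_le_rpow (one_le_pow₀ one_le_two) (by linarith)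

theorem scaleTime_le (j : ℕ) : (scaleTime γ j : ℝ) ≤ 2 * ((2 : ℝ) ^ j) ^ γ := by
  have h1 := Nat.ceil_lt_add_one (show 0 ≤ ((2 : ℝ) ^ j) ^ γ by positivity)
  have h2 := one_le_two_pow_rpow hγ j
  unfold scaleTime
  linarith

theorem one_le_scaleTime (j : ℕ) : 1 ≤ scaleTime γ j := by
  exact_mod_cast (one_le_two_pow_rpow hγ j).trans (le_scaleTime γ j)

theorem scaleTime_mono {i j : ℕ} (h : i ≤ j) : scaleTime γ i ≤ scaleTime γ j :=
  Nat.ceil_mono (Real.rpow_le_rpow (by positivity) (pow_le_pow_right₀ one_le_two h) (by linarith))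

theorem two_pow_le_scaleTime_rpow (j : ℕ) : (2 : ℝ) ^ j ≤ (scaleTime γ j : ℝ) ^ (1 / γ) := by
  have hγ0 : γ ≠ 0 := by linarith
  calc (2 : ℝ) ^ j = (((2 : ℝ) ^ j) ^ γ) ^ (1 / γ) := by
        rw [← Real.rpow_mul (by positivity), mul_one_div_cancel hγ0, Real.rpow_one]
    _ ≤ _ := Real.rpow_le_rpow (by positivity) (le_scaleTime γ j) (by positivity)

/-- At distance at least `2ˡ` times the scale `2ʲ`, the sub-Gaussian factor beats any geometric
sequence in `l`. -/
theorem exists_exp_le_geometric {C b : ℝ} (hC : 0 < C) (hb : 0 < b) :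
    ∃ E, 0 < E ∧ ∀ (j l : ℕ) (r : ℝ), (2 : ℝ) ^ (j + l) ≤ r →
      Real.exp (-((r ^ γ / (C * scaleTime γ j)) ^ (1 / (γ - 1)))) ≤ E * (b⁻¹) ^ l := by
  set σ : ℝ := 1 / (γ - 1)
  have hσ : 0 < σ := one_div_pos.2 (by linarith)
  set θ : ℝ := ((2 : ℝ) ^ γ) ^ σ
  have hθ : 1 < θ := Real.one_lt_rpow (Real.one_lt_rpow one_lt_two (by linarith)) hσ
  set c : ℝ := (1 / (2 * C)) ^ σ
  have hc : 0 < c := Real.rpow_pos_of_pos (by positivity) σ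
  obtain ⟨N, hN⟩ := pow_unbounded_of_one_lt b hθ
  refine ⟨N.factorial / c ^ N, by positivity, fun j l r hr => ?_⟩
  have hm : (0 : ℝ) < scaleTime γ j := by exact_mod_cast one_le_scaleTime hγ j
  have hbase : 1 / (2 * C) * ((2 : ℝ) ^ γ) ^ l ≤ r ^ γ / (C * scaleTime γ j) := by
    rw [le_div_iff₀ (by positivity)]
    have h1 : ((2 : ℝ) ^ j) ^ γ * ((2 : ℝ) ^ γ) ^ l ≤ r ^ γ := by
      rw [Real.rpow_pow_comm (by norm_num), ← Real.mul_rpow (by positivity) (by positivity),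
        ← pow_add]
      exact Real.rpow_le_rpow (by positivity) hr (by linarith)
    have h2 : 1 / (2 * C) * ((2 : ℝ) ^ γ) ^ l * (C * scaleTime γ j) =
        ((2 : ℝ) ^ γ) ^ l * (scaleTime γ j / 2) := by field_simp
    rw [h2]
    have h3 : (scaleTime γ j : ℝ) / 2 ≤ ((2 : ℝ) ^ j) ^ γ := by linarith [scaleTime_le hγ j]
    have := mul_le_mul_of_nonneg_left h3 (show 0 ≤ ((2 : ℝ) ^ γ) ^ l by positivity)
    linarith
  have hx : c * θ ^ l ≤ (r ^ γ / (C * scaleTime γ j)) ^ σ := by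
    refine le_trans (le_of_eq ?_) (Real.rpow_le_rpow (by positivity) hbase hσ.le)
    rw [Real.mul_rpow (by positivity) (by positivity), Real.rpow_pow_comm (by positivity)]
  have hpos : 0 < c * θ ^ l := by positivity
  calc Real.exp (-((r ^ γ / (C * scaleTime γ j)) ^ σ)) ≤ Real.exp (-(c * θ ^ l)) :=
        Real.exp_le_exp.2 (neg_le_neg hx)
    _ = (Real.exp (c * θ ^ l))⁻¹ := Real.exp_neg _
    _ ≤ ((c * θ ^ l) ^ N / N.factorial)⁻¹ :=
        inv_anti₀ (by positivity) (Real.pow_div_factorial_le_exp _ hpos.le N)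
    _ = N.factorial / c ^ N * ((θ ^ N) ^ l)⁻¹ := by
        rw [mul_pow, inv_div, ← pow_mul, ← pow_mul, mul_comm l N]
        field_simp
    _ ≤ N.factorial / c ^ N * (b⁻¹) ^ l := by
        rw [inv_pow]
        gcongr

end ScaleTime

/-- A sum of terms which decay geometrically away from an index `i`. -/
theorem sum_range_le_of_geometric_decay {T : ℕ → ℝ} (hT : ∀ j, 0 ≤ T j) {i : ℕ} {a b r s : ℝ}
    (ha : 0 ≤ a) (hb : 0 ≤ b) (hr : 0 ≤ r) (hr1 : r < 1) (hs : 0 ≤ s) (hs1 : s < 1)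
    (h1 : ∀ l, T (i + l) ≤ a * r ^ l) (h2 : ∀ j l, 0 < l → i = j + l → T j ≤ b * s ^ l) (n : ℕ) :
    ∑ j ∈ Finset.range n, T j ≤ a * (1 - r)⁻¹ + b * (1 - s)⁻¹ := by
  have hgeom : ∀ t : ℝ, 0 ≤ t → t < 1 → ∀ k : ℕ, ∑ l ∈ Finset.range k, t ^ l ≤ (1 - t)⁻¹ :=
    fun t ht ht1 k => by
      rw [← tsum_geometric_of_lt_one ht ht1]
      exact (summable_geometric_of_lt_one ht ht1).sum_le_tsum _ fun l _ => pow_nonneg ht l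
  have hfar : ∑ l ∈ Finset.range n, T (i + l) ≤ a * (1 - r)⁻¹ :=
    (Finset.sum_le_sum fun l _ => h1 l).trans <| by
      rw [← Finset.mul_sum]
      exact mul_le_mul_of_nonneg_left (hgeom r hr hr1 n) ha
  have hnear : ∑ j ∈ Finset.range i, T j ≤ b * (1 - s)⁻¹ := by
    rw [← Finset.sum_range_reflect]
    refine (Finset.sum_le_sum (g := fun l => b * s ^ l) fun l hl => ?_).trans ?_
    · have hl' := Finset.mem_range.1 hl
      refine (h2 (i - 1 - l) (l + 1) l.succ_pos (by omega)).trans (mul_le_mul_of_nonneg_left ?_ hb)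
      exact pow_le_pow_of_le_one hs hs1.le l.le_succ
    · rw [← Finset.mul_sum]
      exact mul_le_mul_of_nonneg_left (hgeom s hs hs1 i) hb
  calc ∑ j ∈ Finset.range n, T j ≤ ∑ j ∈ Finset.range (i + n), T j :=
        Finset.sum_le_sum_of_subset_of_nonneg (Finset.range_mono (Nat.le_add_left n i))
          fun j _ _ => hT j
    _ = ∑ j ∈ Finset.range i, T j + ∑ l ∈ Finset.range n, T (i + l) := Finset.sum_range_add _ _ _
    _ ≤ _ := by linarith

namespace WeightedGraph

variable {Γ : Type*} {G : WeightedGraph Γ} {V φ : ℝ → ℝ} {γ β : ℝ}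

/-- The sub-Gaussian bounds at the dyadic scales, weighted by `1 / φ`, add up to at most a multiple
of `1 / (V φ)`. Scales larger than the distance `n` are summed by means of the growth of `φ`,
smaller ones by means of the sub-Gaussian factor. -/
theorem HasVolumeGrowth.exists_sum_subGaussian_le (hV : G.HasVolumeGrowth V) (hγ : 1 < γ)
    (hcont : ContinuousOn φ (Ici 0)) (hone : ∀ t, 0 ≤ t → 1 ≤ φ t) (hβ : 0 < β)
    (hrv : RegularlyVarying φ β) {C : ℝ} (hC : 0 < C) :
    ∃ A, 0 < A ∧ ∀ n J : ℕ, ∑ j ∈ Finset.range J, (φ (2 ^ j))⁻¹ *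
      (C / V ((scaleTime γ j : ℝ) ^ (1 / γ)) *
        Real.exp (-(((n : ℝ) ^ γ / (C * scaleTime γ j)) ^ (1 / (γ - 1))))) ≤
      A * (1 / (V n * φ n)) := by
  obtain ⟨D, hD1, hD⟩ := hV.doubling
  obtain ⟨M, hM1, hM⟩ := hrv.exists_le_mul hcont hone
  obtain ⟨c, θ, hc, hθ, hgrow⟩ := hrv.exists_geometric_growth hone hβ
  have hD0 : 0 < D := by linarith
  have hM0 : 0 < M := by linarith
  have hθ0 : 0 < θ := by linarith
  obtain ⟨E, hE, hexp⟩ := exists_exp_le_geometric hγ hC (show 0 < 2 * (D * M) by positivity)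
  have hφ0 : ∀ t, 0 ≤ t → 0 < φ t := fun t ht => one_pos.trans_le (hone t ht)
  have hp : ∀ j : ℕ, (0 : ℝ) ≤ 2 ^ j := fun j => by positivity
  have hVpow : ∀ j l : ℕ, V (2 ^ (j + l)) ≤ D ^ l * V (2 ^ j) := by
    intro j l
    induction l with
    | zero => simp
    | succ l ih =>
      have := hD (2 ^ (j + l)) (by positivity)
      rw [← pow_succ'] at this
      calc V (2 ^ (j + (l + 1))) ≤ D * V (2 ^ (j + l)) := this
        _ ≤ D * (D ^ l * V (2 ^ j)) := mul_le_mul_of_nonneg_left ih hD0.le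
        _ = _ := by ring
  have hφpow : ∀ j l : ℕ, φ (2 ^ (j + l)) ≤ M ^ l * φ (2 ^ j) := by
    intro j l
    induction l with
    | zero => simp
    | succ l ih =>
      have h2 : (1 : ℝ) ≤ 2 ^ (j + l) := one_le_pow₀ one_le_two
      have h3 : (1 : ℝ) ≤ 2 ^ (j + (l + 1)) := one_le_pow₀ one_le_two
      have := hM (2 ^ (j + (l + 1))) (2 ^ (j + l)) (hp _) (hp _)
        (by rw [max_eq_left h2, ← add_assoc, pow_succ']) (by
          rw [max_eq_left h3, ← add_assoc, pow_succ']; linarith)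
      calc φ (2 ^ (j + (l + 1))) ≤ M * φ (2 ^ (j + l)) := this
        _ ≤ M * (M ^ l * φ (2 ^ j)) := mul_le_mul_of_nonneg_left ih hM0.le
        _ = _ := by ring
  refine ⟨C * (D * (M * c)) * (1 - θ⁻¹)⁻¹ + C * (D * M) * E * (1 - 1 / 2)⁻¹, ?_,
    fun n J => ?_⟩
  · have : 0 < 1 - θ⁻¹ := sub_pos.2 (inv_lt_one_of_one_lt₀ hθ)
    positivity
  set i := Nat.log 2 n
  have hn0 : (0 : ℝ) ≤ n := n.cast_nonneg
  have hni : (n : ℝ) ≤ 2 ^ (i + 1) := by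
    exact_mod_cast (Nat.lt_pow_succ_log_self one_lt_two n).le
  have hin : n ≠ 0 → (2 : ℝ) ^ i ≤ n := fun h => by exact_mod_cast Nat.pow_log_le_self 2 h
  have hVn : V n ≤ D * V (2 ^ i) := by
    have := hVpow i 1
    rw [pow_one] at this
    exact (hV.mono hn0 hni).trans this
  have hφn : φ n ≤ M * φ (2 ^ i) := by
    refine hM n (2 ^ i) hn0 (hp i) ?_ ?_
    · rw [max_eq_left (one_le_pow₀ one_le_two), ← pow_succ']; exact hni
    · rcases eq_or_ne n 0 with h | h
      · simp [i, h]
      · linarith [hin h, le_max_left (n : ℝ) 1]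
  have hX : 0 < V n * φ n := mul_pos (hV.pos _ hn0) (hφ0 _ hn0)
  -- a term is estimated through a comparison of `V φ` at `n` with `V φ` at the scale
  have hterm : ∀ (j : ℕ) (a e e' : ℝ), 0 ≤ e → e ≤ e' →
      V n * φ n ≤ a * (V (2 ^ j) * φ (2 ^ j)) →
      (φ (2 ^ j))⁻¹ * (C / V ((scaleTime γ j : ℝ) ^ (1 / γ)) * e) ≤
        C * a * e' * (1 / (V n * φ n)) := by
    intro j a e e' he hee h
    have hVj := hV.pos _ (hp j)
    have hφj := hφ0 _ (hp j)
    have h1 : C / V ((scaleTime γ j : ℝ) ^ (1 / γ)) ≤ C / V (2 ^ j) :=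
      div_le_div_of_nonneg_left hC.le hVj (hV.mono (hp j) (two_pow_le_scaleTime_rpow hγ j))
    have h2 : 1 / (V (2 ^ j) * φ (2 ^ j)) ≤ a * (1 / (V n * φ n)) := by
      rw [mul_one_div, div_le_div_iff₀ (by positivity) hX]
      linarith
    calc _ ≤ (φ (2 ^ j))⁻¹ * (C / V (2 ^ j) * e') := by gcongr
      _ = C * e' * (1 / (V (2 ^ j) * φ (2 ^ j))) := by field_simp
      _ ≤ C * e' * (a * (1 / (V n * φ n))) :=
          mul_le_mul_of_nonneg_left h2 (mul_nonneg hC.le (he.trans hee))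
      _ = _ := by ring
  rw [add_mul, mul_right_comm, mul_right_comm _ (1 - 1 / 2 : ℝ)⁻¹]
  have hX' : 0 < 1 / (V n * φ n) := one_div_pos.2 hX
  refine sum_range_le_of_geometric_decay (i := i) (r := θ⁻¹) (s := 1 / 2)
    (fun j => ?_) (by positivity) (by positivity) (by positivity) (inv_lt_one_of_one_lt₀ hθ)
    (by norm_num) (by norm_num) (fun l => ?_) (fun j l hl hjl => ?_) J
  · have h1 := hφ0 _ (hp j)
    have h2 := hV.pos ((scaleTime γ j : ℝ) ^ (1 / γ)) (by positivity)
    positivity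
  · refine (hterm (i + l) (D * (M * c) * (θ⁻¹) ^ l) _ 1 (Real.exp_pos _).le ?_ ?_).trans
      (le_of_eq (by ring))
    · exact Real.exp_le_one_iff.2 (neg_nonpos.2 (by positivity))
    · have h1 : V n ≤ D * V (2 ^ (i + l)) := hVn.trans (mul_le_mul_of_nonneg_left
        (hV.mono (hp i) (pow_le_pow_right₀ one_le_two (Nat.le_add_right i l))) hD0.le)
      have h2 : φ n ≤ M * c * (θ⁻¹) ^ l * φ (2 ^ (i + l)) := by
        refine hφn.trans ?_
        rw [mul_assoc, mul_assoc]
        refine mul_le_mul_of_nonneg_left ?_ hM0.le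
        have := hgrow i l
        rw [inv_pow, mul_left_comm, inv_mul_eq_div, le_div_iff₀ (by positivity)]
        exact this
      calc V n * φ n ≤ D * V (2 ^ (i + l)) * (M * c * (θ⁻¹) ^ l * φ (2 ^ (i + l))) :=
            mul_le_mul h1 h2 (hφ0 _ hn0).le (mul_pos hD0 (hV.pos _ (hp _))).le
        _ = _ := by ring
  · have hn : n ≠ 0 := fun h => by simp [i, h] at hjl; omega
    refine (hterm j (D * M * (D * M) ^ l) _ _ (Real.exp_pos _).le
      (hexp j l n (by rw [← hjl]; exact hin hn)) ?_).trans (le_of_eq ?_)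
    · rw [hjl] at hVn hφn
      have h1 : V n ≤ D * (D ^ l * V (2 ^ j)) :=
        hVn.trans (mul_le_mul_of_nonneg_left (hVpow j l) hD0.le)
      have h2 : φ n ≤ M * (M ^ l * φ (2 ^ j)) :=
        hφn.trans (mul_le_mul_of_nonneg_left (hφpow j l) hM0.le)
      have h3 := hV.pos _ (hp j)
      calc V n * φ n ≤ D * (D ^ l * V (2 ^ j)) * (M * (M ^ l * φ (2 ^ j))) :=
            mul_le_mul h1 h2 (hφ0 _ hn0).le (by positivity)
        _ = _ := by ring
    · rw [show ((2 * (D * M))⁻¹) ^ l = (1 / 2) ^ l / (D * M) ^ l by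
        rw [mul_inv, mul_pow, inv_pow (D * M), div_eq_mul_inv, one_div]]
      field_simp

end WeightedGraph

/-! ### The scale function `η` -/

section Eta

variable {φ : ℝ → ℝ} {γ β : ℝ}

theorem intervalIntegrable_rpow_div (hγ : 1 < γ) (hcont : ContinuousOn φ (Ici 0))
    (hone : ∀ t, 0 ≤ t → 1 ≤ φ t) {a b : ℝ} (ha : 0 ≤ a) (hab : a ≤ b) :
    IntervalIntegrable (fun s => s ^ (γ - 1) / φ s) MeasureTheory.volume a b := by
  refine ContinuousOn.intervalIntegrable ?_
  rw [uIcc_of_le hab]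
  have hsub : Icc a b ⊆ Ici 0 := fun s hs => ha.trans hs.1
  refine ContinuousOn.div (fun s _ => ?_) (hcont.mono hsub) fun s hs =>
    (one_pos.trans_le (hone s (hsub hs))).ne'
  exact (Real.continuousAt_rpow_const s (γ - 1) (Or.inr (by linarith))).continuousWithinAt

theorem integral_rpow_div_ge (hγ : 1 < γ) (hcont : ContinuousOn φ (Ici 0))
    (hone : ∀ t, 0 ≤ t → 1 ≤ φ t) {t D : ℝ} (ht : 0 ≤ t) (hD : ∀ s ∈ Icc 0 t, φ s ≤ D) :
    t ^ γ / (γ * D) ≤ ∫ s in (0 : ℝ)..t, s ^ (γ - 1) / φ s := by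
  have h1 : ∫ s in (0 : ℝ)..t, s ^ (γ - 1) / D = t ^ γ / (γ * D) := by
    rw [intervalIntegral.integral_div, integral_rpow (Or.inl (by linarith)), sub_add_cancel,
      Real.zero_rpow (by linarith), sub_zero, div_div]
  rw [← h1]
  refine intervalIntegral.integral_mono_on ht
    ((intervalIntegral.intervalIntegrable_rpow' (by linarith)).div_const D)
    (intervalIntegrable_rpow_div hγ hcont hone le_rfl ht) fun s hs => ?_
  exact div_le_div_of_nonneg_left (Real.rpow_nonneg hs.1 _)
    (one_pos.trans_le (hone s hs.1)) (hD s hs)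

theorem integral_rpow_div_pos (hγ : 1 < γ) (hcont : ContinuousOn φ (Ici 0))
    (hone : ∀ t, 0 ≤ t → 1 ≤ φ t) {t : ℝ} (ht : 0 < t) :
    0 < ∫ s in (0 : ℝ)..t, s ^ (γ - 1) / φ s := by
  obtain ⟨D, hD⟩ := (isCompact_Icc (a := (0 : ℝ)) (b := t)).bddAbove_image
    (hcont.mono Icc_subset_Ici_self)
  have hD' : ∀ s ∈ Icc 0 t, φ s ≤ D := fun s hs => hD ⟨s, hs, rfl⟩
  have hD0 : 0 < D := (one_pos.trans_le (hone 0 le_rfl)).trans_le (hD' 0 ⟨le_rfl, ht.le⟩)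
  exact lt_of_lt_of_le (by positivity) (integral_rpow_div_ge hγ hcont hone ht.le hD')

/-- `η` is bounded on bounded intervals, so that its supremum there is meaningful. -/
theorem bddAbove_etaFun_image (hγ : 1 < γ) (hcont : ContinuousOn φ (Ici 0))
    (hone : ∀ t, 0 ≤ t → 1 ≤ φ t) (R : ℝ) : BddAbove (etaFun γ φ '' Icc 0 R) := by
  obtain ⟨D, hD⟩ := (isCompact_Icc (a := (0 : ℝ)) (b := R)).bddAbove_image
    (hcont.mono Icc_subset_Ici_self)
  refine ⟨γ * D, ?_⟩
  rintro _ ⟨t, ⟨ht0, htR⟩, rfl⟩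
  have hD' : ∀ s ∈ Icc 0 t, φ s ≤ D := fun s hs => hD ⟨s, ⟨hs.1, hs.2.trans htR⟩, rfl⟩
  have hφD : φ 0 ≤ D := hD' 0 ⟨le_rfl, ht0⟩
  have hD0 : 0 < D := (one_pos.trans_le (hone 0 le_rfl)).trans_le hφD
  rcases ht0.eq_or_lt with rfl | ht
  · rw [etaFun, if_pos rfl]
    exact mul_le_mul_of_nonneg_left hφD (by linarith)
  · rw [etaFun, if_neg ht.ne', div_le_iff₀ (integral_rpow_div_pos hγ hcont hone ht)]
    have h := integral_rpow_div_ge hγ hcont hone ht0 hD'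
    rw [div_le_iff₀ (by positivity)] at h
    linarith

theorem etaFun_le_etaTilde (hγ : 1 < γ) (hcont : ContinuousOn φ (Ici 0))
    (hone : ∀ t, 0 ≤ t → 1 ≤ φ t) {t R : ℝ} (ht : 0 ≤ t) (htR : t ≤ R) :
    etaFun γ φ t ≤ etaTilde γ φ R :=
  le_csSup (bddAbove_etaFun_image hγ hcont hone R) ⟨t, ⟨ht, htR⟩, rfl⟩

/-- The integral which defines `η` is controlled by its dyadic sum. -/
theorem exists_integral_le_sum (hγ : 1 < γ) (hcont : ContinuousOn φ (Ici 0))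
    (hone : ∀ t, 0 ≤ t → 1 ≤ φ t) (hrv : RegularlyVarying φ β) :
    ∃ A, 0 < A ∧ ∀ J : ℕ, ∫ s in (0 : ℝ)..2 ^ (J + 1), s ^ (γ - 1) / φ s ≤
      A * ∑ j ∈ Finset.range (J + 1), ((2 : ℝ) ^ j) ^ γ * (φ (2 ^ j))⁻¹ := by
  obtain ⟨M, hM1, hM⟩ := hrv.exists_le_mul hcont hone
  have hM0 : 0 < M := by linarith
  have hφ0 : ∀ t, 0 ≤ t → 0 < φ t := fun t ht => one_pos.trans_le (hone t ht)
  have hp : ∀ j : ℕ, (1 : ℝ) ≤ 2 ^ j := fun j => one_le_pow₀ one_le_two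
  have hint : ∀ {a b : ℝ}, 0 ≤ a → a ≤ b →
      IntervalIntegrable (fun s => s ^ (γ - 1) / φ s) MeasureTheory.volume a b := fun ha hab =>
    intervalIntegrable_rpow_div hγ hcont hone ha hab
  have hpiece : ∀ (a b : ℝ) (j : ℕ), 0 ≤ a → a ≤ b → b ≤ 2 * 2 ^ j → 2 ^ j ≤ 2 * max a 1 →
      ∫ s in a..b, s ^ (γ - 1) / φ s ≤ b ^ (γ - 1) * (M * (φ (2 ^ j))⁻¹) * (b - a) := by
    intro a b j ha hab hb hj
    have h1 : ∫ _ in a..b, b ^ (γ - 1) * (M * (φ (2 ^ j))⁻¹) =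
        b ^ (γ - 1) * (M * (φ (2 ^ j))⁻¹) * (b - a) := by
      rw [intervalIntegral.integral_const, smul_eq_mul, mul_comm]
    rw [← h1]
    refine intervalIntegral.integral_mono_on hab (hint ha hab) (by simp) fun s hs => ?_
    have hs0 : 0 ≤ s := ha.trans hs.1
    rw [div_eq_mul_inv]
    have h2 : (φ s)⁻¹ ≤ M * (φ (2 ^ j))⁻¹ := by
      rw [← div_eq_mul_inv, inv_eq_one_div, div_le_div_iff₀ (hφ0 s hs0)
        (hφ0 _ (zero_le_one.trans (hp j))), one_mul]
      refine hM _ _ (zero_le_one.trans (hp j)) hs0 (hj.trans ?_) ?_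
      · exact mul_le_mul_of_nonneg_left (max_le_max_right 1 hs.1) two_pos.le
      · rw [max_eq_left (hp j)]; exact hs.2.trans hb
    exact mul_le_mul (Real.rpow_le_rpow hs0 hs.2 (by linarith)) h2
      (inv_nonneg.2 (hφ0 s hs0).le) (Real.rpow_nonneg (hs0.trans hs.2) _)
  set A : ℝ := 2 ^ (γ - 1) * M
  have hA : 0 < A := by positivity
  have hstep : ∀ J : ℕ, ∫ s in (0 : ℝ)..2 ^ J, s ^ (γ - 1) / φ s ≤
      M * (φ 1)⁻¹ + A * ∑ j ∈ Finset.range J, ((2 : ℝ) ^ j) ^ γ * (φ (2 ^ j))⁻¹ := by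
    intro J
    induction J with
    | zero => simpa using hpiece 0 1 0 le_rfl zero_le_one (by norm_num) (by norm_num)
    | succ J ih =>
      have hJ0 : (0 : ℝ) < 2 ^ J := by positivity
      have hle : (2 : ℝ) ^ J ≤ 2 ^ (J + 1) := pow_le_pow_right₀ one_le_two J.le_succ
      rw [← intervalIntegral.integral_add_adjacent_intervals (hint le_rfl hJ0.le)
        (hint hJ0.le hle), Finset.sum_range_succ, mul_add, ← add_assoc]
      refine add_le_add ih ((hpiece _ _ J hJ0.le hle (pow_succ' _ _).le ?_).trans (le_of_eq ?_))
      · rw [max_eq_left (hp J)]; linarith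
      · rw [pow_succ', Real.mul_rpow two_pos.le hJ0.le,
          show (2 : ℝ) * 2 ^ J - 2 ^ J = 2 ^ J by ring]
        have : ((2 : ℝ) ^ J) ^ γ = (2 ^ J) ^ (γ - 1) * 2 ^ J := by
          rw [← Real.rpow_add_one hJ0.ne', sub_add_cancel]
        rw [this]
        ring
  refine ⟨M + A, by positivity, fun J => (hstep (J + 1)).trans ?_⟩
  rw [add_mul]
  refine add_le_add (mul_le_mul_of_nonneg_left ?_ hM0.le) le_rfl
  have := Finset.single_le_sum (f := fun j : ℕ => ((2 : ℝ) ^ j) ^ γ * (φ (2 ^ j))⁻¹)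
    (fun j _ => mul_nonneg (by positivity) (inv_nonneg.2 (hφ0 _ (by positivity)).le))
    (Finset.mem_range.2 J.succ_pos)
  simpa using this

end Eta

/-! ### The Nash inequality -/

namespace WeightedGraph

variable {Γ : Type*} {G : WeightedGraph Γ} {V φ : ℝ → ℝ} {γ β : ℝ} {k : Γ → Γ → ℝ}

/-- A symmetric Markov kernel with respect to `μ` gives a reversible Markov matrix. -/
theorem IsMarkov.isReversibleMarkov (hk : G.IsMarkov k) (hμ : G.ComparableToCounting)
    (hsymm : ∀ x y, k x y = k y x) : G.IsReversibleMarkov fun x y => k x y * G.mu y where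
  nonneg x y := mul_nonneg (hk.1 x y) (hμ.mu_pos y).le
  hasSum_one := hk.2
  balance x y := by rw [hsymm x y]; ring

theorem kernelOp_eq_matrixOp (k : Γ → Γ → ℝ) :
    G.kernelOp k = matrixOp fun x y => k x y * G.mu y := by
  funext f x
  exact tsum_congr fun y => by ring

/-- `ℰ_{K²}(f, f) = ‖f‖² - ‖K f‖²`. -/
theorem dirichletForm_kernelOp_sq (hμ : G.ComparableToCounting) (hk : G.IsMarkov k)
    (hsymm : ∀ x y, k x y = k y x) {f : Γ → ℝ} (hf : G.MemL1 f) :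
    G.dirichletForm ((G.kernelOp k)^[2]) f f =
      G.innerProd f f - G.innerProd (G.kernelOp k f) (G.kernelOp k f) := by
  have hq := hk.isReversibleMarkov hμ hsymm
  have hqi := hq.isInvariantMarkov hμ
  simp only [dirichletForm, Function.iterate_succ, Function.iterate_zero, Function.comp_apply,
    id_eq, kernelOp_eq_matrixOp]
  rw [← hq.innerProd_sq hμ hf]
  have h1 := (hf.mul hμ hf).summable hμ
  have h2 := ((hqi.memL1 _ (hqi.memL1 _ hf)).mul hμ hf).summable hμ
  rw [innerProd, innerProd, innerProd, ← h1.tsum_sub h2]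
  exact tsum_congr fun x => by simp only [Pi.sub_apply]; ring

/-- The energies of the walk at the dyadic scales are jointly controlled by `ℰ_{K²}`. -/
theorem exists_sum_energy_le (hμ : G.ComparableToCounting) (hV : G.HasVolumeGrowth V)
    (hγ : 1 < γ) (hup : G.SubGaussianUpper V γ) (hcont : ContinuousOn φ (Ici 0))
    (hone : ∀ t, 0 ≤ t → 1 ≤ φ t) (hβ : 0 < β) (hrv : RegularlyVarying φ β)
    (hk : G.IsMarkov k) (hJ : G.SatisfiesJ V φ k) :
    ∃ A, 0 < A ∧ ∀ f, G.MemL1 f → 0 ≤ G.dirichletForm ((G.kernelOp k)^[2]) f f ∧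
      ∀ J : ℕ, ∑ j ∈ Finset.range J, (φ (2 ^ j))⁻¹ * G.energy (G.Pn (scaleTime γ j)) f ≤
        A * G.dirichletForm ((G.kernelOp k)^[2]) f f := by
  obtain ⟨hsymm, Cφ, hCφ, hJ⟩ := hJ
  obtain ⟨C, hC, hheat⟩ := hup
  obtain ⟨Cμ, hCμ, hmu⟩ := id hμ
  obtain ⟨A, hA, hsum⟩ := hV.exists_sum_subGaussian_le hγ hcont hone hβ hrv hC
  have hφ0 : ∀ t, 0 ≤ t → 0 < φ t := fun t ht => one_pos.trans_le (hone t ht)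
  have hq := (hk.isReversibleMarkov hμ hsymm).isInvariantMarkov hμ
  set q : Γ → Γ → ℝ := fun x y => k x y * G.mu y
  have hX : 0 < 1 / (V 0 * φ 0) := one_div_pos.2 (mul_pos (hV.pos 0 le_rfl) (hφ0 0 le_rfl))
  set ε : ℝ := Cφ⁻¹ * (1 / (V 0 * φ 0)) * Cμ⁻¹
  have hCμ' : 0 < Cμ⁻¹ := by positivity
  have hε : 0 < ε := by positivity
  have hlazy : ∀ x, ε ≤ q x x := fun x => by
    have h1 := (hJ x x).1
    have hd : G.d x x = 0 := by simp [d]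
    rw [hd] at h1
    exact mul_le_mul h1 (hmu x).1 hCμ'.le (hk.1 x x)
  have hpq : ∀ (J : ℕ) (x y : Γ), ∑ j ∈ Finset.range J, (φ (2 ^ j))⁻¹ * G.Pn (scaleTime γ j) x y ≤
      A * Cφ * q x y := by
    intro J x y
    have hy := hμ.mu_pos y
    have h1 : ∑ j ∈ Finset.range J, (φ (2 ^ j))⁻¹ * G.heatKernel (scaleTime γ j) x y ≤
        A * (1 / (V (G.d x y) * φ (G.d x y))) := by
      refine (Finset.sum_le_sum fun j _ => ?_).trans (hsum (G.graph.dist x y) J)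
      exact mul_le_mul_of_nonneg_left (hheat x y _ (one_le_scaleTime hγ j))
        (inv_nonneg.2 (hφ0 _ (by positivity)).le)
    have h2 : 1 / (V (G.d x y) * φ (G.d x y)) ≤ Cφ * k x y := by
      have := (hJ x y).1
      rwa [inv_mul_le_iff₀ hCφ] at this
    have h3 := mul_le_mul_of_nonneg_right (h1.trans (mul_le_mul_of_nonneg_left h2 hA.le)) hy.le
    rw [Finset.sum_mul] at h3
    refine le_of_eq_of_le (Finset.sum_congr rfl fun j _ => ?_) (h3.trans (le_of_eq ?_))
    · rw [heatKernel, mul_assoc, div_mul_cancel₀ _ hy.ne']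
    · simp only [q]; ring
  refine ⟨A * Cφ * (1 + ε⁻¹), by positivity, fun f hf => ?_⟩
  have hform := dirichletForm_kernelOp_sq hμ hk hsymm hf
  have hlz := hq.energy_le_of_lazy hμ hε hlazy hf
  rw [kernelOp_eq_matrixOp] at hform ⊢
  rw [← hform] at hlz
  refine ⟨?_, fun J => ?_⟩
  · exact nonneg_of_mul_nonneg_right ((energy_nonneg hμ hq f).trans hlz) (by positivity)
  · refine (sum_energy_le_of_sum_le hμ (fun j => isInvariantMarkov_Pn hμ (scaleTime γ j)) hq
      (hpq J) hf).trans ?_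
    rw [mul_assoc (A * Cφ)]
    exact mul_le_mul_of_nonneg_left hlz (by positivity)

/-- The pseudo-Poincaré inequality at the scale `2ᴶ`: by convexity of `n ↦ ‖Pⁿ f‖²`, the loss of
norm at every smaller scale is at least the proportional part of the loss at the scale `2ᴶ`. -/
theorem exists_pseudoPoincare (hμ : G.ComparableToCounting) (hV : G.HasVolumeGrowth V)
    (hγ : 1 < γ) (hup : G.SubGaussianUpper V γ) (hcont : ContinuousOn φ (Ici 0))
    (hone : ∀ t, 0 ≤ t → 1 ≤ φ t) (hβ : 0 < β) (hrv : RegularlyVarying φ β)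
    (hk : G.IsMarkov k) (hJ : G.SatisfiesJ V φ k) :
    ∃ A, 0 < A ∧ ∀ f, G.MemL1 f → 0 ≤ G.dirichletForm ((G.kernelOp k)^[2]) f f ∧
      ∀ J : ℕ, (∑ j ∈ Finset.range (J + 1), ((2 : ℝ) ^ j) ^ γ * (φ (2 ^ j))⁻¹) *
        (G.innerProd f f - G.innerProd (matrixOp (G.Pn (scaleTime γ J)) f)
          (matrixOp (G.Pn (scaleTime γ J)) f)) ≤
        A * ((2 : ℝ) ^ J) ^ γ * G.dirichletForm ((G.kernelOp k)^[2]) f f := by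
  obtain ⟨A, hA, h⟩ := exists_sum_energy_le hμ hV hγ hup hcont hone hβ hrv hk hJ
  refine ⟨2 * A, by positivity, fun f hf => ⟨(h f hf).1, fun J => ?_⟩⟩
  obtain ⟨hE, hsum⟩ := h f hf
  set E := G.dirichletForm ((G.kernelOp k)^[2]) f f
  set b : ℕ → ℝ := fun n => G.innerProd (matrixOp (G.Pn n) f) (matrixOp (G.Pn n) f)
  have hb0 : G.innerProd f f = b 0 := by simp only [b, matrixOp_Pn_zero]
  have hb : ∀ n, 2 * b (n + 1) ≤ b n + b (n + 2) := innerProd_Pn_convex hμ hf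
  have hloss : ∀ n, b 0 - b n ≤ G.energy (G.Pn n) f := fun n => by
    rw [← hb0]; exact (isInvariantMarkov_Pn hμ n).innerProd_sub_le_energy hμ hf
  change (∑ j ∈ Finset.range (J + 1), ((2 : ℝ) ^ j) ^ γ * (φ (2 ^ j))⁻¹) *
    (G.innerProd f f - b (scaleTime γ J)) ≤ 2 * A * ((2 : ℝ) ^ J) ^ γ * E
  rw [hb0]
  have hdec : 0 ≤ b 0 - b (scaleTime γ J) := by
    rw [← hb0]
    exact sub_nonneg.2 ((isInvariantMarkov_Pn hμ (scaleTime γ J)).innerProd_le hμ hf)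
  have hφ0 : ∀ j : ℕ, 0 ≤ (φ (2 ^ j))⁻¹ := fun j =>
    inv_nonneg.2 (zero_le_one.trans (hone _ (by positivity)))
  have hterm : ∀ j ∈ Finset.range (J + 1), ((2 : ℝ) ^ j) ^ γ * (φ (2 ^ j))⁻¹ *
      (b 0 - b (scaleTime γ J)) ≤
      scaleTime γ J * ((φ (2 ^ j))⁻¹ * G.energy (G.Pn (scaleTime γ j)) f) := by
    intro j hj
    have hjJ : j ≤ J := Nat.lt_succ_iff.1 (Finset.mem_range.1 hj)
    have h1 := mul_sub_le_mul_sub_of_convex hb (scaleTime_mono hγ hjJ)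
    have h2 := mul_le_mul_of_nonneg_right (le_scaleTime γ j) hdec
    have h3 := mul_le_mul_of_nonneg_left (hloss (scaleTime γ j))
      (Nat.cast_nonneg (α := ℝ) (scaleTime γ J))
    have h4 := mul_le_mul_of_nonneg_left (h2.trans (h1.trans h3)) (hφ0 j)
    linarith
  rw [Finset.sum_mul]
  refine (Finset.sum_le_sum hterm).trans ?_
  rw [← Finset.mul_sum]
  have h1 := mul_le_mul_of_nonneg_left (hsum (J + 1)) (Nat.cast_nonneg (α := ℝ) (scaleTime γ J))
  have h2 := mul_le_mul_of_nonneg_right (scaleTime_le hγ J) (mul_nonneg hA.le hE)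
  linarith

/-- The pseudo-Poincaré inequality in terms of `η̃`, at a dyadic scale comparable to `r`. -/
theorem exists_pseudoPoincare_etaTilde (hμ : G.ComparableToCounting) (hV : G.HasVolumeGrowth V)
    (hγ : 1 < γ) (hup : G.SubGaussianUpper V γ) (hcont : ContinuousOn φ (Ici 0))
    (hone : ∀ t, 0 ≤ t → 1 ≤ φ t) (hβ : 0 < β) (hrv : RegularlyVarying φ β)
    (hk : G.IsMarkov k) (hJ : G.SatisfiesJ V φ k) :
    ∃ A, 0 < A ∧ ∀ r, 0 ≤ r → ∃ J : ℕ, r ≤ 2 ^ (J + 1) ∧ ∀ f, G.MemL1 f →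
      G.innerProd f f - G.innerProd (matrixOp (G.Pn (scaleTime γ J)) f)
        (matrixOp (G.Pn (scaleTime γ J)) f) ≤
        A * G.dirichletForm ((G.kernelOp k)^[2]) f f * etaTilde γ φ r := by
  obtain ⟨A, hA, h⟩ := exists_pseudoPoincare hμ hV hγ hup hcont hone hβ hrv hk hJ
  obtain ⟨A', hA', hint⟩ := exists_integral_le_sum hγ hcont hone hrv
  have hφ0 : ∀ t, 0 ≤ t → 0 < φ t := fun t ht => one_pos.trans_le (hone t ht)
  have hφ1 := hφ0 1 zero_le_one
  refine ⟨max (A * φ 1) (A * A'), lt_max_of_lt_right (by positivity), fun r hr => ?_⟩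
  rcases lt_or_ge r 1 with hr1 | hr1
  · refine ⟨0, by norm_num; linarith, fun f hf => ?_⟩
    obtain ⟨hE, h'⟩ := h f hf
    have h0 := h' 0
    simp only [zero_add, Finset.range_one, Finset.sum_singleton, pow_zero, Real.one_rpow,
      one_mul, mul_one] at h0
    rw [inv_mul_le_iff₀ hφ1] at h0
    have hη : 1 ≤ etaTilde γ φ r := by
      refine le_trans ?_ (etaFun_le_etaTilde hγ hcont hone le_rfl hr)
      rw [etaFun, if_pos rfl]
      nlinarith [hone 0 le_rfl]
    calc _ ≤ A * φ 1 * G.dirichletForm ((G.kernelOp k)^[2]) f f * 1 := by linarith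
      _ ≤ _ := by
        gcongr
        exact le_max_left _ _
  · -- `J` is the integral part of the binary logarithm of `r`
    obtain ⟨J, hJr, hrJ⟩ := exists_nat_pow_near hr1 one_lt_two
    refine ⟨J, hrJ.le, fun f hf => ?_⟩
    obtain ⟨hE, h'⟩ := h f hf
    have hr0 : 0 < r := by linarith
    have hI := integral_rpow_div_pos hγ hcont hone hr0
    have hIle : ∫ s in (0 : ℝ)..r, s ^ (γ - 1) / φ s ≤
        A' * ∑ j ∈ Finset.range (J + 1), ((2 : ℝ) ^ j) ^ γ * (φ (2 ^ j))⁻¹ := by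
      refine le_trans ?_ (hint J)
      rw [← intervalIntegral.integral_add_adjacent_intervals
        (intervalIntegrable_rpow_div hγ hcont hone le_rfl hr)
        (intervalIntegrable_rpow_div hγ hcont hone hr hrJ.le)]
      refine le_add_of_nonneg_right (intervalIntegral.integral_nonneg hrJ.le fun s hs => ?_)
      have hs0 := hr.trans hs.1
      exact div_nonneg (Real.rpow_nonneg hs0 _) (hφ0 s hs0).le
    have hη := etaFun_le_etaTilde hγ hcont hone hr le_rfl
    rw [etaFun, if_neg hr0.ne'] at hη
    refine le_trans ?_ (mul_le_mul_of_nonneg_left hη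
      (mul_nonneg (lt_max_of_lt_right (by positivity)).le hE))
    set E := G.dirichletForm ((G.kernelOp k)^[2]) f f
    set L := G.innerProd f f - G.innerProd (matrixOp (G.Pn (scaleTime γ J)) f)
        (matrixOp (G.Pn (scaleTime γ J)) f)
    set I := ∫ s in (0 : ℝ)..r, s ^ (γ - 1) / φ s
    set S := ∑ j ∈ Finset.range (J + 1), ((2 : ℝ) ^ j) ^ γ * (φ (2 ^ j))⁻¹
    rw [mul_div_assoc', le_div_iff₀ hI]
    have hrγ : ((2 : ℝ) ^ J) ^ γ ≤ r ^ γ := Real.rpow_le_rpow (by positivity) hJr (by linarith)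
    have hmain : S * L ≤ A * r ^ γ * E := (h' J).trans (by gcongr)
    have hright : A * A' * E * r ^ γ ≤ max (A * φ 1) (A * A') * E * r ^ γ := by
      gcongr
      exact le_max_right _ _
    refine le_trans ?_ hright
    rcases le_total L 0 with hL | hL
    · exact (mul_nonpos_of_nonpos_of_nonneg hL hI.le).trans (by positivity)
    · nlinarith [mul_le_mul_of_nonneg_left hIle hL, mul_le_mul_of_nonneg_left hmain hA'.le]

/-- The on-diagonal heat kernel bound at the dyadic scales, as a bound from `ℓ¹` to `ℓ²`. -/
theorem exists_innerProd_Pn_scaleTime_le (hμ : G.ComparableToCounting) (hV : G.HasVolumeGrowth V)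
    (hγ : 1 < γ) (hup : G.SubGaussianUpper V γ) :
    ∃ A, 0 < A ∧ ∀ (J : ℕ) (r : ℝ), 0 ≤ r → r ≤ 2 ^ (J + 1) → ∀ f, G.MemL1 f →
      G.innerProd (matrixOp (G.Pn (scaleTime γ J)) f) (matrixOp (G.Pn (scaleTime γ J)) f) ≤
        A / V r * G.l1Norm f ^ 2 := by
  obtain ⟨C, hC, hheat⟩ := hup
  obtain ⟨D, hD1, hD⟩ := hV.doubling
  have hD0 : 0 < D := by linarith
  refine ⟨C * D, by positivity, fun J r hr hrJ f hf => ?_⟩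
  refine innerProd_Pn_le_of_heatKernel_le hμ (fun x y => ?_) hf
  have h2 : (0 : ℝ) ≤ 2 ^ J := by positivity
  have hVJ := hV.pos _ h2
  have hVr : V r ≤ D * V (2 ^ J) := by
    refine (hV.mono hr hrJ).trans ?_
    rw [pow_succ']
    exact hD _ (by positivity)
  have hVm : V (2 ^ J) ≤ V ((scaleTime γ J : ℝ) ^ (1 / γ)) :=
    hV.mono h2 (two_pow_le_scaleTime_rpow hγ J)
  have hVm0 := hVJ.trans_le hVm
  have hexp : Real.exp (-((G.d x y ^ γ / (C * scaleTime γ J)) ^ (1 / (γ - 1)))) ≤ 1 := by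
    have : 0 ≤ G.d x y := Nat.cast_nonneg _
    exact Real.exp_le_one_iff.2 (neg_nonpos.2 (by positivity))
  calc _ ≤ C / V ((scaleTime γ J : ℝ) ^ (1 / γ)) *
        Real.exp (-((G.d x y ^ γ / (C * scaleTime γ J)) ^ (1 / (γ - 1)))) :=
        hheat x y _ (one_le_scaleTime hγ J)
    _ ≤ C / V ((scaleTime γ J : ℝ) ^ (1 / γ)) * 1 := by gcongr
    _ ≤ C * D / V r := by
        rw [mul_one, div_le_div_iff₀ hVm0 (hV.pos r hr)]
        have := mul_le_mul_of_nonneg_left (hVr.trans (mul_le_mul_of_nonneg_left hVm hD0.le)) hC.le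
        linarith

theorem l2Norm_sq (hμ : G.ComparableToCounting) (f : Γ → ℝ) :
    G.l2Norm f ^ 2 = G.innerProd f f :=
  Real.sq_sqrt (tsum_nonneg fun x => mul_nonneg (mul_self_nonneg _) (hμ.mu_pos x).le)

theorem innerProd_self_pos (hμ : G.ComparableToCounting) {f : Γ → ℝ} (hf : G.MemL1 f)
    (h0 : f ≠ 0) : 0 < G.innerProd f f := by
  obtain ⟨x, hx⟩ := Function.ne_iff.1 h0
  exact ((hf.mul hμ hf).summable hμ).tsum_pos
    (fun y => mul_nonneg (mul_self_nonneg _) (hμ.mu_pos y).le) x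
    (mul_pos (mul_self_pos.2 hx) (hμ.mu_pos x))

end WeightedGraph

theorem mainTheorem5 {Γ : Type*} [Infinite Γ] (G : WeightedGraph Γ) (V : ℝ → ℝ) (γ : ℝ)
    (hμ : G.ComparableToCounting) (hV : G.HasVolumeGrowth V)
    (hγ : 1 < γ) (hup : G.SubGaussianUpper V γ) (hlow : G.SubGaussianLower V γ)
    (φ : ℝ → ℝ) (hφ_cont : ContinuousOn φ (Set.Ici 0)) (hφ_one : ∀ t, 0 ≤ t → 1 ≤ φ t)
    (β : ℝ) (hβ : 0 < β) (hφ_rv : RegularlyVarying φ β)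
    (k : Γ → Γ → ℝ) (hk : G.IsMarkov k) (hJ : G.SatisfiesJ V φ k) :
    ∃ C₁ : ℝ, 0 < C₁ ∧ ∃ C₂ : ℝ, 0 < C₂ ∧ ∀ f : Γ → ℝ, G.MemL1 f →
      (f ≠ 0 → C₂ * (G.l1Norm f ^ 2 / G.l2Norm f ^ 2) ∈ V '' Set.Ici 0) ∧
      G.l2Norm f ^ 2 ≤
        C₁ * G.dirichletForm ((G.kernelOp k)^[2]) f f *
          etaTilde γ φ (invIci V (C₂ * (G.l1Norm f ^ 2 / G.l2Norm f ^ 2))) := by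
  obtain ⟨A, hA, hpp⟩ :=
    WeightedGraph.exists_pseudoPoincare_etaTilde hμ hV hγ hup hφ_cont hφ_one hβ hφ_rv hk hJ
  obtain ⟨S, hS, hultra⟩ := WeightedGraph.exists_innerProd_Pn_scaleTime_le hμ hV hγ hup
  obtain ⟨C, hC, hsup⟩ := hμ.exists_abs_le
  have hV0 := hV.pos 0 le_rfl
  -- `2 S` makes the smoothed part at most half of `‖f‖₂²`; `C V(0)` puts the ratio in the range
  -- of `V`, as `‖f‖₂² ≤ C ‖f‖₁²`
  refine ⟨2 * A, by positivity, max (2 * S) (C * V 0), lt_max_of_lt_left (by positivity),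
    fun f hf => ?_⟩
  set C₂ := max (2 * S) (C * V 0)
  rw [WeightedGraph.l2Norm_sq hμ]
  have hmem : f ≠ 0 → C₂ * (G.l1Norm f ^ 2 / G.innerProd f f) ∈ V '' Set.Ici 0 := fun h0 => by
    refine hV.mem_image hμ ?_
    have hpos := WeightedGraph.innerProd_self_pos hμ hf h0
    have h1 : G.innerProd f f ≤ C * G.l1Norm f ^ 2 := by
      have := hf.innerProd_self_le hμ (hsup f hf)
      linarith
    rw [mul_div_assoc', le_div_iff₀ hpos]
    calc V 0 * G.innerProd f f ≤ V 0 * (C * G.l1Norm f ^ 2) :=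
          mul_le_mul_of_nonneg_left h1 hV0.le
      _ = C * V 0 * G.l1Norm f ^ 2 := by ring
      _ ≤ _ := mul_le_mul_of_nonneg_right (le_max_right _ _) (sq_nonneg _)
  refine ⟨hmem, ?_⟩
  rcases eq_or_ne f 0 with rfl | h0
  · simp [WeightedGraph.dirichletForm, WeightedGraph.innerProd]
  have hpos := WeightedGraph.innerProd_self_pos hμ hf h0
  have hr0 : invIci V (C₂ * (G.l1Norm f ^ 2 / G.innerProd f f)) ∈ Set.Ici 0 :=
    Function.invFunOn_mem (hmem h0)
  have hVr : V (invIci V (C₂ * (G.l1Norm f ^ 2 / G.innerProd f f))) =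
      C₂ * (G.l1Norm f ^ 2 / G.innerProd f f) := Function.invFunOn_eq (hmem h0)
  set r := invIci V (C₂ * (G.l1Norm f ^ 2 / G.innerProd f f))
  obtain ⟨J, hrJ, hJ'⟩ := hpp r hr0
  have h1 := hJ' f hf
  have h2 := hultra J r hr0 hrJ f hf
  have hVr0 := hV.pos r hr0
  have h3 : S / V r * G.l1Norm f ^ 2 ≤ G.innerProd f f / 2 := by
    rw [div_mul_eq_mul_div, div_le_iff₀ hVr0, hVr]
    have h4 : G.innerProd f f / 2 * (C₂ * (G.l1Norm f ^ 2 / G.innerProd f f)) =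
        C₂ / 2 * G.l1Norm f ^ 2 := by field_simp
    rw [h4]
    refine mul_le_mul_of_nonneg_right ?_ (sq_nonneg _)
    linarith [le_max_left (2 * S) (C * V 0)]
  linarith
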